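/- **Lemma 5.1.** Let $X$ be a locally compact Hausdorff space with countable base, let $\mathcal V$ be a base of the topology of $X$ consisting of relatively compact open sets, and let $(H_V)_{V\in\mathcal V}$ be an elliptic normal Bauer family of harmonic boundary kernels on $X$. Then, for every $x\in X$ and every open neighborhood $V$ of $x$, there exists a strongly stable compact neighborhood $K$ of $x$ with $K\subset V$. Here the following terminology is used. For $U\subset X$ open let $\mathcal V(U):=\{W\in\mathcal V:\overline W\subset U\}$. A *boundary kernel* for $V$ is a (Borel) kernel $H_V$ on $X$ with $H_V(x,X\setminus\partial V)=0$ for $x\in V$ and $H_V(x,\cdot)=\varepsilon_x$ (Dirac measure) for $x\notin V$; we write $H_Vf(x)=\int f(y)\,H_V(x,dy)$. A *local choice* from $\mathcal V$ in $U$ is a map $\mathcal W$ assigning to each $x\in U$ a fundamental system $\mathcal W(x)$ of neighborhoods of $x$ consisting of sets $W\in\mathcal V(U)$ with $x\in W$. A lower semicontinuous function $u\colon U\to\,]-\infty,\infty]$ is *$\mathcal W$-hyperharmonic* on $U$ if $H_Wu(x)\le u(x)$ for all $x\in U$ and $W\in\mathcal W(x)$; it is *hyperharmonic* if this holds with $\mathcal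 W(x)=\{W\in\mathcal V(U):x\in W\}$. A function $h$ is *harmonic* on $U$ if it is continuous and real on $U$ and $H_Wh=h$ for all $W\in\mathcal V(U)$. The family of boundary kernels $(H_V)_{V\in\mathcal V}$ is a *normal Bauer family of harmonic boundary kernels* if, for every $V\in\mathcal V$: 1. $H_WH_V=H_V$ for all $W\in\mathcal V$ with $W\subset V$; 2. $H_V1=1$, and $H_Vf$ is continuous on $X$ for every continuous $f\colon X\to\mathbb R$; 3. there is a local choice $\mathcal W$ from $\mathcal V$ in $V$ such that the $\mathcal W$-hyperharmonic functions $u\ge 0$ on $V$ separate the points of $V$; 4. $H_Vf$ is continuous on $V$ for every bounded Borel function $f$ on $X$. It is *elliptic* if every harmonic function $h\ge0$ on a connected open set $U$ is identically zero or strictly positive on $U$. An open set $W$ is a *$\mathcal P$-set* if the hyperharmonic functions $u\ge0$ on $W$ separate the points of $W$. A compact set $K\neq\emptyset$ is *strongly stable* if it is contained in a $\mathcal P$-set $W$ for which there exists a strictly positive harmonic function $h$ on $W\setminus K$ that tends to zero at $\partial K$, i.e. $\lim_{y\to z,\,y\in W\setminus K}h(y)=0$ for every $z\in\partial K$. -/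

import Mathlib

open Set Filter Topology MeasureTheory ProbabilityTheory

namespace BauerSpace

section Definitions

variable {X : Type*} [TopologicalSpace X] [MeasurableSpace X]

/-- The integral `∫ u dμ = ∫ u⁺ dμ - ∫ u⁻ dμ` of an extended real function. (It is used only for
functions that are bounded below almost everywhere, with respect to probability measures, so that
`∞ - ∞` does not occur.) -/
noncomputable def extIntegral (μ : Measure X) (u : X → EReal) : EReal :=
  ((∫⁻ x, (u x).toENNReal ∂μ : ENNReal) : EReal) -
    ((∫⁻ x, (-(u x)).toENNReal ∂μ : ENNReal) : EReal)

/-- `T` is a boundary kernel for `U`: for `x ∈ U` the measure `T(x, ·)` does not charge the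
complement of `∂U`, and for `x ∉ U` it is the Dirac measure at `x`. -/
def IsBoundaryKernel (U : Set X) (T : Kernel X X) : Prop :=
  (∀ x ∈ U, T x (frontier U)ᶜ = 0) ∧ ∀ x ∉ U, T x = Measure.dirac x

/-- All sets of the base `𝒱` which contain `x` and have their closure in `U`. -/
def nbhdsIn (𝒱 : Set (Set X)) (U : Set X) (x : X) : Set (Set X) :=
  {W | W ∈ 𝒱 ∧ closure W ⊆ U ∧ x ∈ W}

/-- `𝒲` is a local choice from `𝒱` in `U`: for every `x ∈ U`, `𝒲 x` is a fundamental system of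
neighborhoods of `x` consisting of sets of `𝒱` with closure in `U`. -/
def IsLocalChoice (𝒱 : Set (Set X)) (U : Set X) (𝒲 : X → Set (Set X)) : Prop :=
  ∀ x ∈ U, 𝒲 x ⊆ nbhdsIn 𝒱 U x ∧ ∀ N ∈ 𝓝 x, ∃ W ∈ 𝒲 x, W ⊆ N

/-- `u` is `𝒲`-hyperharmonic on `U`. Functions on `U` are given by functions on `X`; only their
values on `U` matter. -/
def IsHyperharmonicFor (H : Set X → Kernel X X) (𝒲 : X → Set (Set X)) (U : Set X)
    (u : X → EReal) : Prop :=
  LowerSemicontinuousOn u U ∧ (∀ x ∈ U, u x ≠ ⊥) ∧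
    ∀ x ∈ U, ∀ W ∈ 𝒲 x, extIntegral (H W x) u ≤ u x

/-- The positive `𝒲`-hyperharmonic functions on `U` separate the points of `U`. -/
def PosHyperharmonicSeparate (H : Set X → Kernel X X) (𝒲 : X → Set (Set X)) (U : Set X) : Prop :=
  ∀ x ∈ U, ∀ y ∈ U, x ≠ y →
    ∃ u : X → EReal, IsHyperharmonicFor H 𝒲 U u ∧ (∀ z ∈ U, 0 ≤ u z) ∧ u x ≠ u y

/-- `h` is harmonic on `U`: continuous and real on `U`, with `H_V h = h` for all `V ∈ 𝒱` with
closure in `U` (outside `V` this equality is trivial). -/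
def IsHarmonicOn (𝒱 : Set (Set X)) (H : Set X → Kernel X X) (U : Set X) (h : X → ℝ) : Prop :=
  ContinuousOn h U ∧ ∀ V ∈ 𝒱, closure V ⊆ U → ∀ x ∈ V, ∫ y, h y ∂(H V x) = h x

/-- `(H_V)`, `V ∈ 𝒱`, is a normal Bauer family of harmonic boundary kernels on `X`, where `𝒱` is a
base of the topology consisting of relatively compact open sets. -/
structure IsNormalBauerFamily (𝒱 : Set (Set X)) (H : Set X → Kernel X X) : Prop where
  isBasis : TopologicalSpace.IsTopologicalBasis 𝒱
  relCompact : ∀ V ∈ 𝒱, IsCompact (closure V)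
  boundary : ∀ V ∈ 𝒱, IsBoundaryKernel V (H V)
  /-- Compatibility `H_W H_V = H_V` for `W ⊆ V`. -/
  compat : ∀ V ∈ 𝒱, ∀ W ∈ 𝒱, W ⊆ V → (H V) ∘ₖ (H W) = H V
  /-- `H_V f` is continuous on `X` for every continuous real `f` on `X`. -/
  continuous : ∀ V ∈ 𝒱, ∀ f : X → ℝ, Continuous f → Continuous fun x => ∫ y, f y ∂(H V x)
  /-- Normality `H_V 1 = 1`. -/
  normal : ∀ V ∈ 𝒱, ∀ x, H V x univ = 1
  /-- Weak separation property. -/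
  separation : ∀ V ∈ 𝒱, ∃ 𝒲, IsLocalChoice 𝒱 V 𝒲 ∧ PosHyperharmonicSeparate H 𝒲 V
  /-- `H_V f` is continuous on `V` for every bounded Borel function `f`. -/
  strongFeller : ∀ V ∈ 𝒱, ∀ f : X → ℝ, Measurable f → (∃ C : ℝ, ∀ x, |f x| ≤ C) →
    ContinuousOn (fun x => ∫ y, f y ∂(H V x)) V

/-- Ellipticity: every positive harmonic function on a connected open set is identically zero or
strictly positive. -/
def IsElliptic (𝒱 : Set (Set X)) (H : Set X → Kernel X X) : Prop :=
  ∀ U : Set X, IsOpen U → IsConnected U → ∀ h : X → ℝ, IsHarmonicOn 𝒱 H U h →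
    (∀ y ∈ U, 0 ≤ h y) → (∀ y ∈ U, h y = 0) ∨ ∀ y ∈ U, 0 < h y

/-- `U` is a `𝒫`-set: an open set whose points are separated by the positive hyperharmonic
functions on `U`. -/
def IsPSet (𝒱 : Set (Set X)) (H : Set X → Kernel X X) (U : Set X) : Prop :=
  IsOpen U ∧ PosHyperharmonicSeparate H (nbhdsIn 𝒱 U) U

/-- `K` is a strongly stable compact: it is non-empty, compact, contained in a `𝒫`-set `W`, and
there is a strictly positive harmonic function on `W \ K` which tends to zero at `∂K`. -/
def IsStronglyStable (𝒱 : Set (Set X)) (H : Set X → Kernel X X) (K : Set X) : Prop :=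
  K.Nonempty ∧ IsCompact K ∧ ∃ W, IsPSet 𝒱 H W ∧ K ⊆ W ∧
    ∃ h : X → ℝ, IsHarmonicOn 𝒱 H (W \ K) h ∧ (∀ y ∈ W \ K, 0 < h y) ∧
      ∀ z ∈ frontier K, Tendsto h (𝓝[W \ K] z) (𝓝 0)

end Definitions

end BauerSpace

set_option linter.unusedSectionVars false

/-! The compact set is a superlevel set of a potential. Take base sets `W`, `V₀` around `x` with
`closure W ⊆ V₀` and `closure V₀ ⊆ V`, and a connected open `B` containing `x` whose closure is a
compact subset of the component `G` of `x` in `W`. Let `g` be bounded, positive and hyperharmonic on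
`V₀`, but not harmonic on `B`. Sweeping `g` onto `closure B` gives `τ`, which equals `g` on `closure
B`, is harmonic on the rest of `V₀` and dominates its means. Then `p = τ - H_W τ` is positive on
`W`, harmonic off `closure B`, and tends to zero at the boundary of `W`, where `τ` is continuous.

If `p` vanished on `B`, then `g = H_W τ` would be harmonic there. So `p` is positive somewhere in
`B`, and ellipticity propagates this: `p` is locally bounded away from zero on `G`. By compactness
`p > a > 0` near `closure B`, and `K = {p ≥ a}` is strongly stable with the function `a - p` on `W \
K`.

The supporting facts are the boundary minimum principle (`nonneg_of_frontier`), which rests on the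
absence of compact absorbing sets; the passage from local to global mean inequalities
(`integral_le`); local connectedness of `X`; the strong minimum principle
(`exists_pos_lower_bound`); and `exists_balayage`. -/

namespace BauerSpace

/-! ### Bounded Borel functions and their means. -/

section BoundedFunctions

variable {X : Type*} [MeasurableSpace X]

/-- Bounded Borel functions. -/
def IsBddBorel (g : X → ℝ) : Prop := Measurable g ∧ ∃ C : ℝ, ∀ x, |g x| ≤ C

theorem IsBddBorel.of_mem_Icc {g : X → ℝ} {C : ℝ} (hm : Measurable g)
    (h : ∀ x, g x ∈ Icc 0 C) : IsBddBorel g :=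
  ⟨hm, C, fun x => by rw [abs_of_nonneg (h x).1]; exact (h x).2⟩

theorem IsBddBorel.integrable {g : X → ℝ} (hg : IsBddBorel g) (μ : Measure X)
    [IsFiniteMeasure μ] : Integrable g μ := by
  obtain ⟨hm, C, hC⟩ := hg
  exact Integrable.of_bound hm.aestronglyMeasurable C (Eventually.of_forall fun x => hC x)

theorem IsBddBorel.sub {f g : X → ℝ} (hf : IsBddBorel f) (hg : IsBddBorel g) :
    IsBddBorel (fun x => f x - g x) := by
  obtain ⟨hm, C, hC⟩ := hf
  obtain ⟨hm', C', hC'⟩ := hg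
  exact ⟨hm.sub hm', C + C', fun x => (abs_sub _ _).trans (add_le_add (hC x) (hC' x))⟩

theorem IsBddBorel.const (c : ℝ) : IsBddBorel (fun _ : X => c) :=
  ⟨measurable_const, |c|, fun _ => le_rfl⟩

theorem IsBddBorel.indicator {g : X → ℝ} (hg : IsBddBorel g) {s : Set X} (hs : MeasurableSet s) :
    IsBddBorel (s.indicator g) := by
  obtain ⟨hm, C, hC⟩ := hg
  refine ⟨hm.indicator hs, C, fun x => ?_⟩
  by_cases hx : x ∈ s
  · simpa [hx] using hC x
  · simpa [hx] using (abs_nonneg _).trans (hC x)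

theorem IsBddBorel.kernel {g : X → ℝ} (hg : IsBddBorel g) (κ : Kernel X X) [IsMarkovKernel κ] :
    IsBddBorel (fun x => ∫ y, g y ∂(κ x)) := by
  obtain ⟨hm, C, hC⟩ := hg
  refine ⟨(hm.stronglyMeasurable.integral_kernel (κ := κ)).measurable, C, fun x => ?_⟩
  have := norm_integral_le_of_norm_le_const (μ := κ x) (f := g) (C := C)
    (Eventually.of_forall fun x => hC x)
  simpa using this

theorem integral_mem_Icc {g : X → ℝ} {C : ℝ} (hm : Measurable g) (h : ∀ x, g x ∈ Icc 0 C)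
    (μ : Measure X) [IsProbabilityMeasure μ] : ∫ y, g y ∂μ ∈ Icc 0 C := by
  refine ⟨integral_nonneg fun y => (h y).1, ?_⟩
  have := integral_mono ((IsBddBorel.of_mem_Icc hm h).integrable μ) (integrable_const C)
    fun y => (h y).2
  simpa using this

/-- A bounded function that is almost everywhere at least its mean is almost everywhere equal to
its mean. -/
theorem ae_eq_of_integral_le {g : X → ℝ} (hg : IsBddBorel g) (μ : Measure X)
    [IsProbabilityMeasure μ] {m : ℝ} (h1 : ∀ᵐ y ∂μ, m ≤ g y) (h2 : ∫ y, g y ∂μ ≤ m) :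
    ∀ᵐ y ∂μ, g y = m := by
  have hi := hg.integrable μ
  have h3 : ∫ y, (g y - m) ∂μ = 0 := by
    apply le_antisymm
    · rw [integral_sub hi (integrable_const m)]
      simpa using h2
    · exact integral_nonneg_of_ae (by filter_upwards [h1] with y hy; simpa using hy)
  have h4 := (integral_eq_zero_iff_of_nonneg_ae (f := fun y => g y - m)
    (by filter_upwards [h1] with y hy; simpa using hy) (hi.sub (integrable_const m))).1 h3
  filter_upwards [h4] with y hy
  simpa [sub_eq_zero] using hy

end BoundedFunctions

/-! ### Elementary properties of the kernels. -/

section Kernels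

variable {X : Type*} [TopologicalSpace X] [T2Space X] [LocallyCompactSpace X]
  [SecondCountableTopology X] [MeasurableSpace X] [BorelSpace X]
  {𝒱 : Set (Set X)} {H : Set X → Kernel X X}

namespace IsNormalBauerFamily

variable (hH : IsNormalBauerFamily 𝒱 H) {V W : Set X} {x y : X} {g : X → ℝ}
include hH

theorem isOpen (hV : V ∈ 𝒱) : IsOpen V := hH.isBasis.isOpen hV

theorem isMarkovKernel (hV : V ∈ 𝒱) : IsMarkovKernel (H V) :=
  ⟨fun x => ⟨hH.normal V hV x⟩⟩

theorem isProbabilityMeasure (hV : V ∈ 𝒱) (x : X) : IsProbabilityMeasure (H V x) :=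
  ⟨hH.normal V hV x⟩

theorem ae_mem_frontier (hV : V ∈ 𝒱) (hy : y ∈ V) : ∀ᵐ z ∂(H V y), z ∈ frontier V :=
  (hH.boundary V hV).1 y hy

theorem integral_of_notMem (hV : V ∈ 𝒱) (hy : y ∉ V) (g : X → ℝ) :
    ∫ z, g z ∂(H V y) = g y := by
  rw [(hH.boundary V hV).2 y hy, integral_dirac]

theorem kernel (hV : V ∈ 𝒱) (hg : IsBddBorel g) :
    IsBddBorel (fun x => ∫ y, g y ∂(H V x)) :=
  have := hH.isMarkovKernel hV
  IsBddBorel.kernel hg (H V)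

theorem integrable (hV : V ∈ 𝒱) (hg : IsBddBorel g) (y : X) : Integrable g (H V y) :=
  have := hH.isProbabilityMeasure hV y
  hg.integrable _

theorem integral_integral (hV : V ∈ 𝒱) (hW : W ∈ 𝒱) (hWV : W ⊆ V) (hg : IsBddBorel g) (y : X) :
    ∫ z, ∫ w, g w ∂(H V z) ∂(H W y) = ∫ w, g w ∂(H V y) := by
  have := hH.isMarkovKernel hV
  have := hH.isMarkovKernel hW
  conv_rhs => rw [← hH.compat V hV W hW hWV]
  rw [Kernel.integral_comp (hg.integrable _)]

theorem integral_mono (hV : V ∈ 𝒱) (hy : y ∈ V) {f g : X → ℝ} (hf : IsBddBorel f)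
    (hg : IsBddBorel g) (h : ∀ z ∈ frontier V, f z ≤ g z) :
    ∫ z, f z ∂(H V y) ≤ ∫ z, g z ∂(H V y) := by
  refine integral_mono_ae (hH.integrable hV hf y) (hH.integrable hV hg y) ?_
  filter_upwards [hH.ae_mem_frontier hV hy] with z hz using h z hz

theorem integral_const (hV : V ∈ 𝒱) (c : ℝ) (y : X) : ∫ _, c ∂(H V y) = c := by
  have := hH.isProbabilityMeasure hV y
  simp

theorem integral_sub (hV : V ∈ 𝒱) {f g : X → ℝ} (hf : IsBddBorel f) (hg : IsBddBorel g) (y : X) :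
    ∫ z, (f z - g z) ∂(H V y) = ∫ z, f z ∂(H V y) - ∫ z, g z ∂(H V y) :=
  MeasureTheory.integral_sub (hH.integrable hV hf y) (hH.integrable hV hg y)

theorem continuousOn_integral (hV : V ∈ 𝒱) (hg : IsBddBorel g) :
    ContinuousOn (fun x => ∫ y, g y ∂(H V x)) V :=
  hH.strongFeller V hV g hg.1 hg.2

/-- Every neighborhood of a point contains the closure of a member of the base. -/
theorem exists_closure_subset {N : Set X} (hN : N ∈ 𝓝 y) : ∃ W ∈ 𝒱, y ∈ W ∧ closure W ⊆ N := by
  obtain ⟨K, hK, hKc, hKN⟩ := exists_mem_nhds_isClosed_subset hN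
  obtain ⟨W, hW, hyW, hWK⟩ := hH.isBasis.mem_nhds_iff.1 hK
  exact ⟨W, hW, hyW, (closure_minimal hWK hKc).trans hKN⟩

end IsNormalBauerFamily

end Kernels

end BauerSpace

namespace BauerSpace

/-! ### Truncation of extended real hyperharmonic functions. -/

section Truncation

variable {X : Type*} [TopologicalSpace X] [MeasurableSpace X]

/-- `g` is a Borel function with values in `[0, C]` which is lower semicontinuous on `U`. -/
structure IsBddLsc (U : Set X) (C : ℝ) (g : X → ℝ) : Prop where
  measurable : Measurable g
  mem_Icc : ∀ x, g x ∈ Icc 0 C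
  lsc : LowerSemicontinuousOn g U

theorem IsBddLsc.isBddBorel {U : Set X} {C : ℝ} {g : X → ℝ} (h : IsBddLsc U C g) : IsBddBorel g :=
  .of_mem_Icc h.measurable h.mem_Icc

/-- A local choice for which the bounded positive hyperharmonic functions separate the points. -/
structure IsSeparatingChoice (𝒱 : Set (Set X)) (H : Set X → Kernel X X) (U : Set X)
    (𝒲 : X → Set (Set X)) : Prop where
  choice : IsLocalChoice 𝒱 U 𝒲
  separates : ∀ a ∈ U, ∀ b ∈ U, a ≠ b → ∃ (C : ℝ) (g : X → ℝ), IsBddLsc U C g ∧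
    (∀ y ∈ U, ∀ W ∈ 𝒲 y, ∫ z, g z ∂(H W y) ≤ g y) ∧ g a ≠ g b

theorem coe_toReal_min {a : EReal} (ha : 0 ≤ a) {c : ℝ} (hc : 0 ≤ c) :
    (((min a (c : EReal)).toReal : ℝ) : EReal) = min a (c : EReal) := by
  refine EReal.coe_toReal (ne_of_lt ?_) (ne_of_gt ?_)
  · exact (min_le_right _ _).trans_lt (EReal.coe_lt_top c)
  · exact EReal.bot_lt_zero.trans_le (le_min ha (by exact_mod_cast hc))

variable [BorelSpace X]

theorem isBddLsc_truncation {U : Set X} (hU : IsOpen U) {v : X → EReal}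
    (hv : LowerSemicontinuousOn v U) (h0 : ∀ z ∈ U, 0 ≤ v z) {c : ℝ} (hc : 0 ≤ c) :
    IsBddLsc U c (U.indicator fun y => (min (v y) (c : EReal)).toReal) := by
  set g := U.indicator fun y => (min (v y) (c : EReal)).toReal with hg
  have hgU : ∀ y ∈ U, (g y : EReal) = min (v y) (c : EReal) := fun y hy => by
    rw [hg, indicator_of_mem hy, coe_toReal_min (h0 y hy) hc]
  have hmem : ∀ y, g y ∈ Icc 0 c := fun y => by
    by_cases hy : y ∈ U
    · have h1 := hgU y hy
      have h2 : (0 : EReal) ≤ g y := h1 ▸ le_min (h0 y hy) (by exact_mod_cast hc)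
      have h3 : (g y : EReal) ≤ c := h1 ▸ min_le_right _ _
      exact ⟨by exact_mod_cast h2, by exact_mod_cast h3⟩
    · rw [hg, indicator_of_notMem hy]
      exact ⟨le_rfl, hc⟩
  have hlsc : LowerSemicontinuousOn g U := by
    intro y hy t ht
    have h1 : (t : EReal) < min (v y) (c : EReal) := by
      rw [← hgU y hy]
      exact_mod_cast ht
    filter_upwards [hv y hy t (h1.trans_le (min_le_left _ _)), self_mem_nhdsWithin] with z hz hzU
    have h2 : (t : EReal) < g z := by
      rw [hgU z hzU]
      exact lt_min hz (h1.trans_le (min_le_right _ _))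
    exact_mod_cast h2
  refine ⟨LowerSemicontinuous.measurable fun y t ht => ?_, hmem, hlsc⟩
  by_cases hy : y ∈ U
  · have := hlsc y hy t ht
    rwa [hU.nhdsWithin_eq hy] at this
  · refine Eventually.of_forall fun z => ?_
    rw [hg, indicator_of_notMem hy] at ht
    exact ht.trans_le (hmem z).1

theorem integral_truncation_le {U : Set X} (hU : IsOpen U) {v : X → EReal}
    (hv : LowerSemicontinuousOn v U) (h0 : ∀ z ∈ U, 0 ≤ v z) {c : ℝ} (hc : 0 ≤ c)
    {μ : Measure X} [IsProbabilityMeasure μ] (hμ : ∀ᵐ z ∂μ, z ∈ U) {y : X} (hy : y ∈ U)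
    (hle : extIntegral μ v ≤ v y) :
    ∫ z, U.indicator (fun y => (min (v y) (c : EReal)).toReal) z ∂μ ≤
      U.indicator (fun y => (min (v y) (c : EReal)).toReal) y := by
  have hB := isBddLsc_truncation hU hv h0 hc
  set g := U.indicator fun y => (min (v y) (c : EReal)).toReal with hg
  have hgU : ∀ y ∈ U, (g y : EReal) = min (v y) (c : EReal) := fun y hy => by
    rw [hg, indicator_of_mem hy, coe_toReal_min (h0 y hy) hc]
  have h1 : (∫ z, g z ∂μ : ℝ) ≤ c := (integral_mem_Icc hB.measurable hB.mem_Icc μ).2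
  have h2 : ((∫ z, g z ∂μ : ℝ) : EReal) ≤ v y := by
    refine le_trans ?_ hle
    have hneg : ∫⁻ z, (-(v z)).toENNReal ∂μ = 0 := by
      rw [lintegral_congr_ae (g := fun _ => 0), lintegral_zero]
      filter_upwards [hμ] with z hz
      exact EReal.toENNReal_of_nonpos (by simpa using h0 z hz)
    rw [extIntegral, hneg]
    simp only [EReal.coe_ennreal_zero, sub_zero]
    have h3 := ofReal_integral_eq_lintegral_ofReal (hB.isBddBorel.integrable μ)
      (Eventually.of_forall fun z => (hB.mem_Icc z).1)
    have h4 : ((∫ z, g z ∂μ : ℝ) : EReal) = ((∫⁻ z, ENNReal.ofReal (g z) ∂μ : ENNReal) : EReal) := by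
      rw [← h3, EReal.coe_ennreal_ofReal, max_eq_left]
      exact integral_nonneg fun z => (hB.mem_Icc z).1
    rw [h4, EReal.coe_ennreal_le_coe_ennreal_iff]
    refine lintegral_mono_ae ?_
    filter_upwards [hμ] with z hz
    rw [← EReal.coe_ennreal_le_coe_ennreal_iff, EReal.coe_toENNReal (h0 z hz),
      EReal.coe_ennreal_ofReal, max_eq_left (hB.mem_Icc z).1, hgU z hz]
    exact min_le_left _ _
  have h5 : ((∫ z, g z ∂μ : ℝ) : EReal) ≤ g y := by
    rw [hgU y hy]
    exact le_min h2 (by exact_mod_cast h1)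
  exact_mod_cast h5

end Truncation

/-! ### Absorbing sets and the boundary minimum principle. -/

section MinimumPrinciple

variable {X : Type*} [TopologicalSpace X] [T2Space X] [LocallyCompactSpace X]
  [SecondCountableTopology X] [MeasurableSpace X] [BorelSpace X]
  {𝒱 : Set (Set X)} {H : Set X → Kernel X X} {𝒲 : X → Set (Set X)} {V₀ : Set X}

/-- Cutting `u` at a real level strictly between its two values keeps them apart, preserves the mean
inequality and makes the function bounded, so that Bochner integrals can replace `extIntegral`. -/
theorem IsNormalBauerFamily.exists_isSeparatingChoice (hH : IsNormalBauerFamily 𝒱 H)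
    {V : Set X} (hV : V ∈ 𝒱) : ∃ 𝒲, IsSeparatingChoice 𝒱 H V 𝒲 := by
  obtain ⟨𝒲, hc, hs⟩ := hH.separation V hV
  have key : ∀ a ∈ V, ∀ b ∈ V, ∀ u : X → EReal, IsHyperharmonicFor H 𝒲 V u →
      (∀ z ∈ V, 0 ≤ u z) → u a < u b → ∃ (C : ℝ) (g : X → ℝ), IsBddLsc V C g ∧
        (∀ y ∈ V, ∀ W ∈ 𝒲 y, ∫ z, g z ∂(H W y) ≤ g y) ∧ g a ≠ g b := by
    intro a ha b hb u hu h0 hab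
    obtain ⟨c, hac, hcb⟩ := EReal.lt_iff_exists_real_btwn.1 hab
    have hc0 : 0 ≤ c := by
      have := (h0 a ha).trans hac.le
      exact_mod_cast this
    refine ⟨c, _, isBddLsc_truncation (hH.isOpen hV) hu.1 h0 hc0, fun y hy W hW => ?_, ?_⟩
    · obtain ⟨hW𝒱, hWV, hyW⟩ := (hc y hy).1 hW
      have := hH.isProbabilityMeasure hW𝒱 y
      refine integral_truncation_le (hH.isOpen hV) hu.1 h0 hc0 ?_ hy (hu.2.2 y hy W hW)
      filter_upwards [hH.ae_mem_frontier hW𝒱 hyW] with z hz using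
        hWV (frontier_subset_closure hz)
    · intro h
      rw [indicator_of_mem ha, indicator_of_mem hb] at h
      have h' := congrArg (fun r : ℝ => (r : EReal)) h
      rw [coe_toReal_min (h0 a ha) hc0, coe_toReal_min (h0 b hb) hc0,
        min_eq_left hac.le, min_eq_right hcb.le] at h'
      exact hac.ne h'
  refine ⟨𝒲, hc, fun a ha b hb hab => ?_⟩
  obtain ⟨u, hu, h0, hne⟩ := hs a ha b hb hab
  rcases lt_or_gt_of_ne hne with h | h
  · exact key a ha b hb u hu h0 h
  · obtain ⟨C, g, h1, h2, h3⟩ := key b hb a ha u hu h0 h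
    exact ⟨C, g, h1, h2, h3.symm⟩

/-- The sublevel sets of a lower semicontinuous function on a compact set are compact. -/
theorem isClosed_sublevel {M : Set X} (hM : IsClosed M) {g : X → ℝ}
    (hg : LowerSemicontinuousOn g M) (t : ℝ) : IsClosed {y ∈ M | g y ≤ t} := by
  rw [← isOpen_compl_iff, isOpen_iff_mem_nhds]
  intro y hy
  by_cases hyM : y ∈ M
  · have hlt : t < g y := by
      by_contra hle
      exact hy ⟨hyM, not_lt.1 hle⟩
    have := hg y hyM t hlt
    rw [eventually_nhdsWithin_iff] at this
    filter_upwards [this] with z hz hzM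
    exact absurd (hz hzM.1) (not_lt.2 hzM.2)
  · filter_upwards [hM.isOpen_compl.mem_nhds hyM] with z hz hzM using hz hzM.1

/-- There are no absorbing compact sets. -/
theorem IsSeparatingChoice.false_of_absorbing (hS : IsSeparatingChoice 𝒱 H V₀ 𝒲)
    (hH : IsNormalBauerFamily 𝒱 H) {M : Set X} (hM : IsCompact M) (hne : M.Nonempty)
    (hMV : M ⊆ V₀) (N : X → Set X) (hN : ∀ y ∈ M, N y ∈ 𝓝 y)
    (habs : ∀ y ∈ M, ∀ W ∈ 𝒲 y, W ⊆ N y → H W y Mᶜ = 0) : False := by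
  -- Zorn's lemma yields a minimal absorbing set. Separating functions force it to be a single
  -- point, and a point is not absorbing.
  let S : Set (Set X) := {A | IsClosed A ∧ A.Nonempty ∧ A ⊆ M ∧
    ∀ y ∈ A, ∀ W ∈ 𝒲 y, W ⊆ N y → H W y Aᶜ = 0}
  obtain ⟨A, -, hA⟩ : ∃ A, A ⊆ M ∧ Minimal (· ∈ S) A := by
    refine zorn_superset_nonempty S (fun c hcS hc hcne => ?_) M ⟨hM.isClosed, hne, subset_rfl, habs⟩
    obtain ⟨A₀, hA₀⟩ := hcne
    refine ⟨⋂₀ c, ⟨isClosed_sInter fun A hA => (hcS hA).1, ?_,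
      (sInter_subset_of_mem hA₀).trans (hcS hA₀).2.2.1, fun y hy W hW hWN => ?_⟩,
      fun A hA => sInter_subset_of_mem hA⟩
    · have : Nonempty c := ⟨⟨A₀, hA₀⟩⟩
      exact IsCompact.nonempty_sInter_of_directed_nonempty_isCompact_isClosed
        (fun A hA B hB => (hc.total hA hB).elim (fun h => ⟨A, hA, subset_rfl, h⟩)
          fun h => ⟨B, hB, h, subset_rfl⟩) (fun A hA => (hcS hA).2.1)
        (fun A hA => hM.of_isClosed_subset (hcS hA).1 (hcS hA).2.2.1) fun A hA => (hcS hA).1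
    -- The chain may be uncountable; second countability reduces the union of complements to a
    -- countable one, which is null.
    · rw [compl_sInter]
      obtain ⟨T, hTc, hT, hTeq⟩ := TopologicalSpace.isOpen_sUnion_countable (compl '' c)
        (by rintro _ ⟨A, hA, rfl⟩; exact (hcS hA).1.isOpen_compl)
      rw [← hTeq, measure_sUnion_null_iff hTc]
      intro s hs
      obtain ⟨A, hA, rfl⟩ := hT hs
      exact (hcS hA).2.2.2 y (hy A hA) W hW hWN
  obtain ⟨hAc, ⟨a, ha⟩, hAM, hAabs⟩ := hA.prop
  have hAV := hAM.trans hMV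
  have hsing : ∀ b ∈ A, b = a := by
    intro b hb
    by_contra hba
    obtain ⟨C, g, hg, hgW, hgne⟩ := hS.separates b (hAV hb) a (hAV ha) hba
    obtain ⟨y₁, hy₁, hmin⟩ := (hg.lsc.mono hAV).exists_isMinOn ⟨a, ha⟩
      (hM.of_isClosed_subset hAc hAM)
    -- The set where `g` attains its minimum over `A` is again absorbing, because a mean that does
    -- not exceed the minimum forces equality almost everywhere. By minimality `g` is constant on
    -- `A`.
    have hB : {y ∈ A | g y ≤ g y₁} ∈ S := by
      refine ⟨isClosed_sublevel hAc (hg.lsc.mono hAV) _, ⟨y₁, hy₁, le_rfl⟩,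
        (sep_subset _ _).trans hAM, fun y hy W hW hWN => ?_⟩
      obtain ⟨hW𝒱, -, -⟩ := (hS.choice y (hAV hy.1)).1 hW
      have := hH.isProbabilityMeasure hW𝒱 y
      have h1 : ∀ᵐ z ∂(H W y), z ∈ A := hAabs y hy.1 W hW hWN
      have h2 := ae_eq_of_integral_le hg.isBddBorel (H W y) (m := g y₁)
        (by filter_upwards [h1] with z hz using hmin hz)
        ((hgW y (hAV hy.1) W hW).trans hy.2)
      change ∀ᵐ z ∂(H W y), z ∈ {y ∈ A | g y ≤ g y₁}
      filter_upwards [h1, h2] with z hz hz' using ⟨hz, hz'.le⟩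
    have hsub := hA.le_of_le hB (sep_subset _ _)
    have e1 := le_antisymm (hsub hb).2 (hmin hb)
    have e2 := le_antisymm (hsub ha).2 (hmin ha)
    exact hgne (e1.trans e2.symm)
  obtain ⟨W, hW, hWN⟩ := (hS.choice a (hAV ha)).2 (N a) (hN a (hAM ha))
  obtain ⟨hW𝒱, -, haW⟩ := (hS.choice a (hAV ha)).1 hW
  have := hH.isProbabilityMeasure hW𝒱 a
  have h1 : ∀ᵐ z ∂(H W a), z ∈ A := hAabs a ha W hW hWN
  have h3 : ∀ᵐ z ∂(H W a), False := by
    filter_upwards [h1, hH.ae_mem_frontier hW𝒱 haW] with z hz hzf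
    rw [hsing z hz, (hH.isOpen hW𝒱).frontier_eq] at hzf
    exact hzf.2 haW
  have h4 := ae_iff.1 h3
  simp at h4

/-- `g` dominates its means with respect to all sufficiently small sets of `𝒲`. -/
def IsLocallySupermean (H : Set X → Kernel X X) (𝒲 : X → Set (Set X)) (U : Set X)
    (g : X → ℝ) : Prop :=
  ∀ y ∈ U, ∃ N ∈ 𝓝 y, ∀ W ∈ 𝒲 y, W ⊆ N → ∫ z, g z ∂(H W y) ≤ g y

/-- The boundary minimum principle. -/
theorem IsSeparatingChoice.nonneg_of_frontier (hS : IsSeparatingChoice 𝒱 H V₀ 𝒲)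
    (hH : IsNormalBauerFamily 𝒱 H) {U : Set X} (hU : IsOpen U) (hUV : U ⊆ V₀)
    (hUc : IsCompact (closure U)) {g : X → ℝ} (hg : IsBddBorel g)
    (hlsc : LowerSemicontinuousOn g U) (hsup : IsLocallySupermean H 𝒲 U g)
    (hbd : ∀ z ∈ frontier U, ∀ ε > 0, ∀ᶠ y in 𝓝[U] z, -ε < g y) :
    ∀ y ∈ U, 0 ≤ g y := by
  by_contra! hneg
  obtain ⟨y₀, hy₀, hlt⟩ := hneg
  -- The boundary condition keeps negative sublevel sets away from `frontier U`, so they are closed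
  -- in `X`, hence compact, and a negative infimum is attained on an absorbing set.
  have hclosed : ∀ t < 0, IsClosed {y ∈ U | g y ≤ t} := by
    intro t ht
    rw [← closure_subset_iff_isClosed]
    intro z hz
    have hzU : z ∈ U := by
      by_contra hzU
      have hzf : z ∈ frontier U := by
        rw [hU.frontier_eq]
        exact ⟨closure_mono (sep_subset _ _) hz, hzU⟩
      have h1 := hbd z hzf (-t) (by linarith)
      rw [eventually_nhdsWithin_iff] at h1
      obtain ⟨y, hy, hy'⟩ := (mem_closure_iff_frequently.1 hz).and_eventually h1 |>.exists
      have := hy' hy.1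
      linarith [hy.2]
    refine ⟨hzU, not_lt.1 fun hlt => ?_⟩
    have h1 := hlsc z hzU t hlt
    rw [eventually_nhdsWithin_iff] at h1
    obtain ⟨y, hy, hy'⟩ := (mem_closure_iff_frequently.1 hz).and_eventually h1 |>.exists
    linarith [hy' hy.1, hy.2]
  have hcomp : ∀ t < 0, IsCompact {y ∈ U | g y ≤ t} := fun t ht =>
    hUc.of_isClosed_subset (hclosed t ht) ((sep_subset _ _).trans subset_closure)
  obtain ⟨y₁, hy₁, hmin⟩ := LowerSemicontinuousOn.exists_isMinOn (f := g)
    (s := {y ∈ U | g y ≤ g y₀}) ⟨y₀, hy₀, le_rfl⟩ (hcomp _ hlt) (hlsc.mono (sep_subset _ _))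
  have hmin' : ∀ y ∈ U, g y₁ ≤ g y := fun y hy => by
    rcases le_total (g y) (g y₀) with h | h
    · exact hmin ⟨hy, h⟩
    · exact hy₁.2.trans h
  have hex : ∀ y ∈ U, ∃ N ∈ 𝓝 y, closure N ⊆ U ∧
      ∀ W ∈ 𝒲 y, W ⊆ N → ∫ z, g z ∂(H W y) ≤ g y := by
    intro y hy
    obtain ⟨N, hN, hNW⟩ := hsup y hy
    obtain ⟨O, hO, hyO, hOU⟩ := hH.exists_closure_subset (hU.mem_nhds hy)
    exact ⟨N ∩ O, inter_mem hN ((hH.isOpen hO).mem_nhds hyO),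
      (closure_mono inter_subset_right).trans hOU,
      fun W hW hWN => hNW W hW (hWN.trans inter_subset_left)⟩
  choose! N hN hNU hNW using hex
  refine hS.false_of_absorbing hH (hcomp (g y₁) (hy₁.2.trans_lt hlt)) ⟨y₁, hy₁.1, le_rfl⟩
    ((sep_subset _ _).trans hUV) N (fun y hy => hN y hy.1) ?_
  · rintro y ⟨hyU, hy⟩ W hW hWN
    have hWU : closure W ⊆ U := (closure_mono hWN).trans (hNU y hyU)
    obtain ⟨hW𝒱, -, hyW⟩ := (hS.choice y (hUV hyU)).1 hW
    have := hH.isProbabilityMeasure hW𝒱 y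
    have h1 : ∀ᵐ z ∂(H W y), z ∈ U := by
      filter_upwards [hH.ae_mem_frontier hW𝒱 hyW] with z hz using hWU (frontier_subset_closure hz)
    have h2 := ae_eq_of_integral_le hg (H W y) (m := g y₁)
      (by filter_upwards [h1] with z hz using hmin' z hz)
      ((hNW y hyU W hW hWN).trans hy)
    change ∀ᵐ z ∂(H W y), z ∈ {y ∈ U | g y ≤ g y₁}
    filter_upwards [h1, h2] with z hz hz' using ⟨hz, hz'.le⟩

end MinimumPrinciple

end BauerSpace

namespace BauerSpace

/-! ### Lipschitz regularization of lower semicontinuous functions. -/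

section Approximation

variable {X : Type*} [TopologicalSpace X] [T2Space X] [LocallyCompactSpace X]
  [SecondCountableTopology X]

/-- A bounded positive lower semicontinuous function on a closed set is the limit of continuous
minorants. -/
theorem exists_continuous_tendsto_of_lsc {S : Set X} {g : X → ℝ} {C : ℝ}
    (hg : ∀ x, g x ∈ Icc 0 C) (hlsc : LowerSemicontinuousOn g S) :
    ∃ f : ℕ → X → ℝ, (∀ n, Continuous (f n)) ∧ (∀ n x, f n x ∈ Icc 0 C) ∧
      (∀ n, ∀ x ∈ S, f n x ≤ g x) ∧ ∀ x ∈ S, Tendsto (fun n => f n x) atTop (𝓝 (g x)) := by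
  classical
  let := TopologicalSpace.metrizableSpaceMetric X
  -- The value `C` off `S` never lowers the infimal convolution below what `g` allows on `S`. For `n
  -- ≥ C / δ`, points at distance at least `δ` do not matter either.
  set G : X → ℝ := fun y => if y ∈ S then g y else C with hG
  have hG0 : ∀ y, 0 ≤ G y := fun y => by
    simp only [hG]
    split_ifs
    · exact (hg y).1
    · exact (hg y).1.trans (hg y).2
  have hGC : ∀ y, G y ≤ C := fun y => by
    simp only [hG]
    split_ifs
    · exact (hg y).2
    · exact le_rfl
  have hterm : ∀ (n : ℕ) x y, 0 ≤ G y + n * dist x y := fun n x y =>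
    add_nonneg (hG0 y) (by positivity)
  have hbdd : ∀ (n : ℕ) x, BddBelow (range fun y => G y + n * dist x y) := fun n x =>
    ⟨0, by rintro _ ⟨y, rfl⟩; exact hterm n x y⟩
  have hleG : ∀ (n : ℕ) x, (⨅ y, (G y + n * dist x y)) ≤ G x := fun n x => by
    simpa using ciInf_le (hbdd n x) x
  refine ⟨fun n x => ⨅ y, (G y + n * dist x y), fun n => ?_, fun n x => ⟨?_, ?_⟩,
    fun n x hx => ?_, fun x hx => ?_⟩
  · refine LipschitzWith.continuous (K := n) (LipschitzWith.of_le_add_mul _ fun x z => ?_)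
    have : Nonempty X := ⟨x⟩
    rw [← sub_le_iff_le_add]
    refine le_ciInf fun y => ?_
    have h1 : (⨅ y, (G y + n * dist x y)) ≤ G y + n * dist x y := ciInf_le (hbdd n x) y
    have h2 : (n : ℝ) * dist x y ≤ n * dist x z + n * dist z y := by
      rw [← mul_add]
      exact mul_le_mul_of_nonneg_left (dist_triangle x z y) (Nat.cast_nonneg n)
    simp only [NNReal.coe_natCast]
    linarith
  · exact Real.iInf_nonneg fun y => hterm n x y
  · exact (hleG n x).trans (hGC x)
  · simpa [hG, hx] using hleG n x
  · have : Nonempty X := ⟨x⟩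
    have hGx : G x = g x := by simp [hG, hx]
    rw [Metric.tendsto_atTop]
    intro ε hε
    have h1 := hlsc x hx (g x - ε / 2) (by linarith)
    rw [eventually_nhdsWithin_iff, Metric.eventually_nhds_iff] at h1
    obtain ⟨δ, hδ, h1⟩ := h1
    obtain ⟨n₀, hn₀⟩ := exists_nat_ge (C / δ)
    refine ⟨n₀, fun n hn => ?_⟩
    have hup : (⨅ y, (G y + n * dist x y)) ≤ g x := hGx ▸ hleG n x
    have hlow : g x - ε / 2 ≤ ⨅ y, (G y + n * dist x y) := by
      refine le_ciInf fun y => ?_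
      rcases lt_or_ge (dist y x) δ with hd | hd
      · have h2 : g x - ε / 2 ≤ G y := by
          simp only [hG]
          split_ifs with hy
          · exact (h1 hd hy).le
          · linarith [(hg x).2]
        have : 0 ≤ (n : ℝ) * dist x y := by positivity
        linarith
      · have hn' : C / δ ≤ n := hn₀.trans (by exact_mod_cast hn)
        have h3 : C ≤ n * dist x y := by
          rw [div_le_iff₀ hδ] at hn'
          rw [dist_comm] at hd
          exact hn'.trans (mul_le_mul_of_nonneg_left hd (Nat.cast_nonneg n))
        linarith [(hg x).2, hG0 y]
    rw [Real.dist_eq, abs_lt]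
    constructor <;> linarith

end Approximation

/-! ### From local to global mean inequalities. -/

section Hyperharmonic

variable {X : Type*} [TopologicalSpace X] [T2Space X] [LocallyCompactSpace X]
  [SecondCountableTopology X] [MeasurableSpace X] [BorelSpace X]
  {𝒱 : Set (Set X)} {H : Set X → Kernel X X} {𝒲 : X → Set (Set X)} {V₀ : Set X}

/-- The integrals of a function that is lower semicontinuous on the boundary are lower
semicontinuous at the boundary. -/
theorem IsNormalBauerFamily.eventually_lt_integral (hH : IsNormalBauerFamily 𝒱 H) {D : Set X}
    (hD : D ∈ 𝒱) {C : ℝ} {g : X → ℝ} (hg : IsBddLsc (frontier D) C g) {z : X}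
    (hz : z ∈ frontier D) {t : ℝ} (ht : t < g z) :
    ∀ᶠ y in 𝓝[D] z, t < ∫ w, g w ∂(H D y) := by
  obtain ⟨f, hfc, hfC, hfg, hft⟩ := exists_continuous_tendsto_of_lsc hg.mem_Icc hg.lsc
  obtain ⟨n, hn⟩ := ((hft z hz).eventually (lt_mem_nhds ht)).exists
  have hzD : z ∉ D := by
    rw [(hH.isOpen hD).frontier_eq] at hz
    exact hz.2
  have h1 : ∀ᶠ y in 𝓝[D] z, t < ∫ w, f n w ∂(H D y) := by
    refine nhdsWithin_le_nhds ((hH.continuous D hD (f n) (hfc n)).continuousAt.eventually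
      (lt_mem_nhds ?_))
    simpa only [hH.integral_of_notMem hD hzD] using hn
  filter_upwards [h1, self_mem_nhdsWithin] with y hy hyD
  exact hy.trans_le (hH.integral_mono hD hyD (.of_mem_Icc (hfc n).measurable (hfC n))
    hg.isBddBorel (hfg n))

/-- For continuous minorants `f n` of `g` on `frontier D`, the difference `g - H_D (f n)` is locally
supermean in `D` with nonnegative lower limits at the boundary, so the minimum principle applies;
dominated convergence then replaces `f n` by `g`. -/
theorem IsSeparatingChoice.integral_le (hS : IsSeparatingChoice 𝒱 H V₀ 𝒲)
    (hH : IsNormalBauerFamily 𝒱 H) {U : Set X} (hUV : U ⊆ V₀) {C : ℝ} {g : X → ℝ}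
    (hg : IsBddLsc U C g) (hsup : IsLocallySupermean H 𝒲 U g) {D : Set X} (hD : D ∈ 𝒱)
    (hDU : closure D ⊆ U) (y : X) : ∫ z, g z ∂(H D y) ≤ g y := by
  by_cases hy : y ∈ D
  swap
  · exact (hH.integral_of_notMem hD hy g).le
  have hfr : frontier D ⊆ U := frontier_subset_closure.trans hDU
  have hDo := hH.isOpen hD
  obtain ⟨f, hfc, hfC, hfg, hft⟩ := exists_continuous_tendsto_of_lsc hg.mem_Icc (hg.lsc.mono hfr)
  have hfB : ∀ n, IsBddBorel (f n) := fun n => .of_mem_Icc (hfc n).measurable (hfC n)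
  have hDsub : D ⊆ U := subset_closure.trans hDU
  have key : ∀ n, ∫ z, f n z ∂(H D y) ≤ g y := by
    intro n
    have hcont := hH.continuous D hD (f n) (hfc n)
    have := hS.nonneg_of_frontier hH hDo (hDsub.trans hUV) (hH.relCompact D hD)
      (g := fun y => g y - ∫ z, f n z ∂(H D y)) (hg.isBddBorel.sub (hH.kernel hD (hfB n))) ?_ ?_ ?_
      y hy
    · simpa using this
    · have h1 := (hg.lsc.mono hDsub).add (hcont.neg.lowerSemicontinuous.lowerSemicontinuousOn D)
      simpa [sub_eq_add_neg] using h1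
    · intro w hw
      obtain ⟨N, hN, hNW⟩ := hsup w (hDsub hw)
      refine ⟨N ∩ D, inter_mem hN (hDo.mem_nhds hw), fun W hW hWN => ?_⟩
      have hW𝒱 := ((hS.choice w (hUV (hDsub hw))).1 hW).1
      rw [hH.integral_sub hW𝒱 hg.isBddBorel (hH.kernel hD (hfB n)),
        hH.integral_integral hD hW𝒱 (hWN.trans inter_subset_right) (hfB n)]
      exact sub_le_sub_right (hNW W hW (hWN.trans inter_subset_left)) _
    · intro z hz ε hε
      have hzD : z ∉ D := by
        rw [hDo.frontier_eq] at hz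
        exact hz.2
      have h1 := (hg.lsc z (hfr hz) (g z - ε / 2) (by linarith)).filter_mono
        (nhdsWithin_mono z hDsub)
      have h2 : ∀ᶠ y in 𝓝[D] z, ∫ w, f n w ∂(H D y) < g z + ε / 2 := by
        refine nhdsWithin_le_nhds (hcont.continuousAt.eventually (gt_mem_nhds ?_))
        simp only [hH.integral_of_notMem hD hzD]
        linarith [hfg n z hz]
      filter_upwards [h1, h2] with y h1 h2
      linarith
  have := hH.isProbabilityMeasure hD y
  refine le_of_tendsto' (tendsto_integral_of_dominated_convergence (fun _ => C)
    (fun n => (hfc n).aestronglyMeasurable) (integrable_const C) (fun n =>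
      Eventually.of_forall fun z => ?_) ?_) key
  · rw [Real.norm_eq_abs, abs_of_nonneg (hfC n z).1]
    exact (hfC n z).2
  · filter_upwards [hH.ae_mem_frontier hD hy] with z hz using hft z hz

/-- Continuous functions which are locally harmonic are harmonic. -/
theorem IsSeparatingChoice.integral_eq (hS : IsSeparatingChoice 𝒱 H V₀ 𝒲)
    (hH : IsNormalBauerFamily 𝒱 H) {U : Set X} (hUV : U ⊆ V₀) {C : ℝ} {g : X → ℝ}
    (hg : Measurable g) (hgC : ∀ x, g x ∈ Icc 0 C) (hc : ContinuousOn g U)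
    (hloc : ∀ y ∈ U, ∃ N ∈ 𝓝 y, ∀ W ∈ 𝒲 y, W ⊆ N → ∫ z, g z ∂(H W y) = g y) {D : Set X}
    (hD : D ∈ 𝒱) (hDU : closure D ⊆ U) (y : X) : ∫ z, g z ∂(H D y) = g y := by
  have hB : IsBddBorel g := .of_mem_Icc hg hgC
  apply le_antisymm
  · refine hS.integral_le hH hUV ⟨hg, hgC, hc.lowerSemicontinuousOn⟩ (fun y hy => ?_) hD hDU y
    obtain ⟨N, hN, h⟩ := hloc y hy
    exact ⟨N, hN, fun W hW hWN => (h W hW hWN).le⟩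
  -- Since constants are preserved by the kernels, the reverse inequality is the same statement for
  -- `C - g`.
  · have h1 := hS.integral_le hH hUV (C := C) (g := fun y => C - g y)
      ⟨measurable_const.sub hg, fun x => ⟨by linarith [(hgC x).2], by linarith [(hgC x).1]⟩,
        (continuousOn_const.sub hc).lowerSemicontinuousOn⟩ (fun y hy => ?_) hD hDU y
    · rw [hH.integral_sub hD (.const C) hB, hH.integral_const hD] at h1
      linarith
    · obtain ⟨N, hN, h⟩ := hloc y hy
      refine ⟨N, hN, fun W hW hWN => ?_⟩
      have hW𝒱 := ((hS.choice y (hUV hy)).1 hW).1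
      rw [hH.integral_sub hW𝒱 (.const C) hB, hH.integral_const hW𝒱, h W hW hWN]

theorem extIntegral_coe {μ : Measure X} [IsProbabilityMeasure μ] {g : X → ℝ} {C : ℝ}
    (hg : Measurable g) (hgC : ∀ x, g x ∈ Icc 0 C) :
    extIntegral μ (fun y => (g y : EReal)) = ((∫ y, g y ∂μ : ℝ) : EReal) := by
  have h3 := ofReal_integral_eq_lintegral_ofReal ((IsBddBorel.of_mem_Icc hg hgC).integrable μ)
    (Eventually.of_forall fun z => (hgC z).1)
  have hneg : ∀ x, (-(g x : EReal)).toENNReal = 0 := fun x =>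
    EReal.toENNReal_of_nonpos (by simpa using (hgC x).1)
  simp only [extIntegral, hneg, EReal.toENNReal_of_ne_top (EReal.coe_ne_top _), EReal.toReal_coe,
    ← h3, lintegral_zero, EReal.coe_ennreal_zero, sub_zero, EReal.coe_ennreal_ofReal]
  rw [max_eq_left (integral_nonneg fun z => (hgC z).1)]

/-- The separating functions of `V₀` satisfy the mean inequality only for sets of `𝒲`; `integral_le`
extends it to all base sets, so their restrictions to `U` are hyperharmonic. -/
theorem IsSeparatingChoice.isPSet (hS : IsSeparatingChoice 𝒱 H V₀ 𝒲)
    (hH : IsNormalBauerFamily 𝒱 H) {U : Set X} (hU : IsOpen U) (hUV : U ⊆ V₀) :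
    IsPSet 𝒱 H U := by
  refine ⟨hU, fun a ha b hb hab => ?_⟩
  obtain ⟨C, g, hg, hgW, hne⟩ := hS.separates a (hUV ha) b (hUV hb) hab
  refine ⟨fun y => (g y : EReal), ⟨?_, fun y _ => EReal.coe_ne_bot _, ?_⟩, fun z _ => ?_, ?_⟩
  · exact continuous_coe_real_ereal.comp_lowerSemicontinuousOn (hg.lsc.mono hUV)
      fun _ _ h => EReal.coe_le_coe h
  · rintro y hy W ⟨hW, hWU, -⟩
    have := hH.isProbabilityMeasure hW y
    rw [extIntegral_coe hg.measurable hg.mem_Icc]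
    exact EReal.coe_le_coe (hS.integral_le hH subset_rfl hg
      (fun y hy => ⟨univ, univ_mem, fun W hW _ => hgW y hy W hW⟩) hW (hWU.trans hUV) y)
  · exact EReal.coe_nonneg.2 (hg.mem_Icc z).1
  · exact fun h => hne (EReal.coe_injective h)

end Hyperharmonic

/-! ### Local connectedness of the space. -/

section LocallyConnected

variable {X : Type*} [TopologicalSpace X] [T2Space X] [LocallyCompactSpace X]
  [SecondCountableTopology X] [MeasurableSpace X] [BorelSpace X]
  {𝒱 : Set (Set X)} {H : Set X → Kernel X X} {𝒲 : X → Set (Set X)} {V₀ : Set X}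

/-- Relatively clopen sets are absorbing. -/
theorem IsSeparatingChoice.ae_mem_of_clopen (hS : IsSeparatingChoice 𝒱 H V₀ 𝒲)
    (hH : IsNormalBauerFamily 𝒱 H) {U A B : Set X} (hUV : U ⊆ V₀) (hA : IsOpen A) (hB : IsOpen B)
    (hAB : Disjoint A B) (hU : A ∪ B = U) {W : Set X} (hW : W ∈ 𝒱) (hWU : closure W ⊆ U) {y : X}
    (hyW : y ∈ W) (hyA : y ∈ A) : ∀ᵐ z ∂(H W y), z ∈ A := by
  have hWo := hH.isOpen hW
  have hfr : frontier W ⊆ U := frontier_subset_closure.trans hWU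
  have hcA : IsClosed (frontier W ∩ A) := by
    have : frontier W ∩ A = frontier W ∩ Bᶜ := by
      ext z
      constructor
      · rintro ⟨h1, h2⟩
        exact ⟨h1, fun h3 => hAB.le_bot ⟨h2, h3⟩⟩
      · rintro ⟨h1, h2⟩
        have := hfr h1
        rw [← hU] at this
        exact ⟨h1, this.resolve_right h2⟩
    rw [this]
    exact isClosed_frontier.inter hB.isClosed_compl
  have hcB : IsClosed (frontier W ∩ Aᶜ) := isClosed_frontier.inter hA.isClosed_compl
  -- The frontier of `W ∩ A` lies in `frontier W ∩ A`, where `f = 0`. The minimum principle for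
  -- `-H_W f` on `W ∩ A` gives `H_W f ≤ 0` there, so `H_W` does not charge the part of `frontier W`
  -- off `A`, where `f = 1`.
  obtain ⟨f, hf0, hf1, hf⟩ := exists_continuous_zero_one_of_isClosed hcA hcB
    (disjoint_left.2 fun z h1 h2 => h2.2 h1.2)
  have hfB : IsBddBorel f := .of_mem_Icc f.continuous.measurable hf
  have hcont := hH.continuous W hW f f.continuous
  have hWA : ∀ {z}, z ∈ frontier (W ∩ A) → z ∈ frontier W ∩ A := by
    intro z hz
    rw [(hWo.inter hA).frontier_eq] at hz
    have hzW : z ∈ closure W := closure_mono inter_subset_left hz.1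
    have hzA : z ∈ A := by
      have := hWU hzW
      rw [← hU] at this
      refine this.resolve_right fun hzB => ?_
      obtain ⟨w, hw, hw'⟩ := mem_closure_iff.1 hz.1 B hB hzB
      exact hAB.le_bot ⟨hw'.2, hw⟩
    refine ⟨?_, hzA⟩
    rw [hWo.frontier_eq]
    exact ⟨hzW, fun h => hz.2 ⟨h, hzA⟩⟩
  have hWV : W ⊆ V₀ := subset_closure.trans (hWU.trans hUV)
  have h0 := hS.nonneg_of_frontier hH (hWo.inter hA) (inter_subset_left.trans hWV)
    ((hH.relCompact W hW).of_isClosed_subset isClosed_closure (closure_mono inter_subset_left))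
    (g := fun y => 0 - ∫ z, f z ∂(H W y)) ((IsBddBorel.const 0).sub (hH.kernel hW hfB))
    (continuous_const.sub hcont).continuousOn.lowerSemicontinuousOn ?_ ?_ y ⟨hyW, hyA⟩
  · have := hH.isProbabilityMeasure hW y
    have h1 := ae_eq_of_integral_le hfB (H W y) (m := 0)
      (Eventually.of_forall fun z => (hf z).1) (by simpa using h0)
    filter_upwards [h1, hH.ae_mem_frontier hW hyW] with z hz hzW
    by_contra hzA
    have := hf1 ⟨hzW, hzA⟩
    simp [hz] at this
  · intro w hw
    refine ⟨W, hWo.mem_nhds hw.1, fun W' hW' hW'W => ?_⟩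
    have hW𝒱 := ((hS.choice w (hWV hw.1)).1 hW').1
    rw [hH.integral_sub hW𝒱 (.const 0) (hH.kernel hW hfB), hH.integral_const hW𝒱,
      hH.integral_integral hW hW𝒱 hW'W hfB]
  · intro z hz ε hε
    obtain ⟨hzW, hzA⟩ := hWA hz
    refine nhdsWithin_le_nhds ((continuous_const.sub hcont).continuousAt.eventually
      (lt_mem_nhds ?_))
    have hzW' : z ∉ W := by
      rw [hWo.frontier_eq] at hzW
      exact hzW.2
    simpa [hH.integral_of_notMem hW hzW', hf0 ⟨hzW, hzA⟩] using hε

/-- Every open subset of `V₀` is a disjoint union of connected open sets. -/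
theorem IsSeparatingChoice.exists_isConnected (hS : IsSeparatingChoice 𝒱 H V₀ 𝒲)
    (hH : IsNormalBauerFamily 𝒱 H) {U : Set X} (hUo : IsOpen U) (hUV : U ⊆ V₀) {x : X}
    (hx : x ∈ U) : ∃ Q ⊆ U, IsOpen Q ∧ x ∈ Q ∧ IsConnected Q := by
  -- `Q` below is the quasi-component of `x` in `U`: the union of all relatively clopen sets
  -- avoiding `x` is removed.
  let S : Set (Set X) := {B | IsOpen B ∧ x ∉ B ∧ ∃ A, IsOpen A ∧ Disjoint A B ∧ A ∪ B = U}
  obtain ⟨T, hTc, hTS, hTeq⟩ := TopologicalSpace.isOpen_sUnion_countable S fun B hB => hB.1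
  set Q := U \ ⋃₀ S with hQ
  have hSU : ∀ B ∈ S, B ⊆ U := by
    rintro B ⟨-, -, A, -, -, h⟩
    exact h ▸ subset_union_right
  have hQm : MeasurableSet Q :=
    hUo.measurableSet.diff (isOpen_sUnion fun B hB => hB.1).measurableSet
  have hxQ : x ∈ Q := ⟨hx, fun ⟨B, hB, hxB⟩ => hB.2.1 hxB⟩
  have habs : ∀ W ∈ 𝒱, closure W ⊆ U → ∀ y ∈ W, y ∈ Q → ∀ᵐ z ∂(H W y), z ∈ Q := by
    intro W hW hWU y hy hyQ
    have h1 : ∀ᵐ z ∂(H W y), ∀ B ∈ T, z ∉ B := by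
      rw [ae_ball_iff hTc]
      intro B hB
      obtain ⟨hBo, hxB, A, hA, hAB, hABU⟩ := hTS hB
      have hyA : y ∈ A := by
        have := hyQ.1
        rw [← hABU] at this
        exact this.resolve_right fun h => hyQ.2 ⟨B, hTS hB, h⟩
      filter_upwards [hS.ae_mem_of_clopen hH hUV hA hBo hAB hABU hW hWU hy hyA] with z hz hzB using
        hAB.le_bot ⟨hz, hzB⟩
    filter_upwards [h1, hH.ae_mem_frontier hW hy] with z hz hzW
    refine ⟨hWU (frontier_subset_closure hzW), ?_⟩
    rw [← hTeq]
    rintro ⟨B, hB, hzB⟩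
    exact hz B hB hzB
  have habs' : ∀ W ∈ 𝒱, closure W ⊆ U → ∀ y ∈ W, y ∉ Q → ∀ᵐ z ∂(H W y), z ∉ Q := by
    intro W hW hWU y hy hyQ
    have hyU : y ∈ U := hWU (subset_closure hy)
    have : y ∈ ⋃₀ S := by
      by_contra h
      exact hyQ ⟨hyU, h⟩
    obtain ⟨B, hB, hyB⟩ := this
    obtain ⟨hBo, hxB, A, hA, hAB, hABU⟩ := hB
    filter_upwards [hS.ae_mem_of_clopen hH hUV hBo hA hAB.symm (by rw [union_comm, hABU]) hW hWU
      hy hyB] with z hz hzQ using hzQ.2 ⟨B, ⟨hBo, hxB, A, hA, hAB, hABU⟩, hz⟩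
  have hQo : IsOpen Q := by
    rw [isOpen_iff_mem_nhds]
    intro y hyQ
    obtain ⟨W, hW, hyW, hWU⟩ := hH.exists_closure_subset (hUo.mem_nhds hyQ.1)
    -- Both `Q` and `U \ Q` are absorbing, so on `W` the function `H_W 1_Q` equals `1_Q`. It is
    -- continuous by the strong Feller property, hence `Q` is open.
    have hB : IsBddBorel (Q.indicator fun _ => (1 : ℝ)) := (IsBddBorel.const 1).indicator hQm
    have h1 : ∫ z, Q.indicator (fun _ => (1 : ℝ)) z ∂(H W y) = 1 := by
      refine Eq.trans ?_ (hH.integral_const hW 1 y)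
      refine integral_congr_ae ?_
      filter_upwards [habs W hW hWU y hyW hyQ] with z hz
      simp [hz]
    have h2 := ((hH.continuousOn_integral hW hB).continuousAt
      ((hH.isOpen hW).mem_nhds hyW)).eventually (lt_mem_nhds (a := 1 / 2)
        (by simp only [h1]; exact one_half_lt_one))
    filter_upwards [h2, (hH.isOpen hW).mem_nhds hyW] with w hw hwW
    by_contra hwQ
    have h3 : ∫ z, Q.indicator (fun _ => (1 : ℝ)) z ∂(H W w) = 0 := by
      refine Eq.trans ?_ (hH.integral_const hW 0 w)
      refine integral_congr_ae ?_
      filter_upwards [habs' W hW hWU w hwW hwQ] with z hz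
      simp [hz]
    rw [h3] at hw
    norm_num at hw
  refine ⟨Q, sdiff_subset, hQo, hxQ, ⟨x, hxQ⟩, ?_⟩
  -- As `Q` and `U \ Q` are open, a splitting of `Q` extends to one of `U`, and the piece without
  -- `x` would already have been removed.
  have key : ∀ u v : Set X, IsOpen u → IsOpen v → Q ⊆ u ∪ v → Q ∩ (u ∩ v) = ∅ → x ∈ u → Q ⊆ u := by
    intro u v hu hv hQuv hdis hxu z hz
    by_contra hzu
    refine hz.2 ⟨(Q ∩ v) ∪ ⋃₀ S, ⟨(hQo.inter hv).union (isOpen_sUnion fun B hB => hB.1), ?_,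
      Q ∩ u, hQo.inter hu, ?_, ?_⟩, Or.inl ⟨hz, (hQuv hz).resolve_left hzu⟩⟩
    · rintro (h | h)
      · exact (hdis ▸ (⟨hxQ, hxu, h.2⟩ : x ∈ Q ∩ (u ∩ v)) : x ∈ (∅ : Set X))
      · exact hxQ.2 h
    · rw [disjoint_left]
      rintro w ⟨hwQ, hwu⟩ (h | h)
      · exact (hdis ▸ (⟨hwQ, hwu, h.2⟩ : w ∈ Q ∩ (u ∩ v)) : w ∈ (∅ : Set X))
      · exact hwQ.2 h
    · ext w
      constructor
      · rintro (h | h | ⟨B, hB, h⟩)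
        · exact h.1.1
        · exact h.1.1
        · exact hSU B hB h
      · intro hw
        by_cases h : w ∈ ⋃₀ S
        · exact Or.inr (Or.inr h)
        · rcases hQuv ⟨hw, h⟩ with h' | h'
          · exact Or.inl ⟨⟨hw, h⟩, h'⟩
          · exact Or.inr (Or.inl ⟨⟨hw, h⟩, h'⟩)
  rw [isPreconnected_iff_subset_of_disjoint]
  intro u v hu hv hQuv hdis
  rcases hQuv hxQ with h | h
  · exact Or.inl (key u v hu hv hQuv hdis h)
  · exact Or.inr (key v u hv hu (by rwa [union_comm]) (by rwa [inter_comm v u]) h)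

/-- Ellipticity speaks only of connected open sets; this makes it applicable to components of open
sets. -/
theorem IsNormalBauerFamily.locallyConnectedSpace (hH : IsNormalBauerFamily 𝒱 H) :
    LocallyConnectedSpace X := by
  rw [locallyConnectedSpace_iff_subsets_isOpen_isConnected]
  intro x U hU
  obtain ⟨V, hV, hxV, -⟩ := hH.isBasis.mem_nhds_iff.1 (univ_mem (f := 𝓝 x))
  obtain ⟨𝒲, hS⟩ := hH.exists_isSeparatingChoice hV
  obtain ⟨Q, hQU, hQ, hxQ, hQc⟩ := hS.exists_isConnected hH
    ((isOpen_interior (s := U)).inter (hH.isOpen hV)) inter_subset_right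
    ⟨mem_interior_iff_mem_nhds.2 hU, hxV⟩
  exact ⟨Q, (hQU.trans inter_subset_left).trans interior_subset, hQ, hxQ, hQc⟩

end LocallyConnected

end BauerSpace

namespace BauerSpace

/-! ### Ellipticity and the strong minimum principle. -/

section StrongMinimumPrinciple

variable {X : Type*} [TopologicalSpace X] [T2Space X] [LocallyCompactSpace X]
  [SecondCountableTopology X] [MeasurableSpace X] [BorelSpace X]
  {𝒱 : Set (Set X)} {H : Set X → Kernel X X}

theorem IsNormalBauerFamily.isHarmonicOn_integral (hH : IsNormalBauerFamily 𝒱 H) {D U : Set X}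
    (hD : D ∈ 𝒱) (hUD : U ⊆ D) {p : X → ℝ} (hp : IsBddBorel p) :
    IsHarmonicOn 𝒱 H U fun y => ∫ z, p z ∂(H D y) :=
  ⟨(hH.continuousOn_integral hD hp).mono hUD, fun _ hV hVU y _ =>
    hH.integral_integral hD hV (subset_closure.trans (hVU.trans hUD)) hp y⟩

/-- The strong minimum principle for positive functions dominating their means. -/
theorem IsNormalBauerFamily.exists_pos_lower_bound (hH : IsNormalBauerFamily 𝒱 H)
    (hell : IsElliptic 𝒱 H) {G : Set X} (hG : IsOpen G) (hGc : IsPreconnected G) {p : X → ℝ}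
    (hp : IsBddBorel p) (h0 : ∀ y, 0 ≤ p y)
    (hsup : ∀ D ∈ 𝒱, closure D ⊆ G → ∀ y ∈ D, ∫ z, p z ∂(H D y) ≤ p y)
    {D₀ : Set X} (hD₀ : D₀ ∈ 𝒱) (hD₀G : closure D₀ ⊆ G) {y₀ : X} (hy₀ : y₀ ∈ D₀)
    (hpos : 0 < ∫ z, p z ∂(H D₀ y₀)) : ∀ y ∈ G, ∃ δ > 0, ∀ᶠ z in 𝓝 y, δ ≤ p z := by
  have := hH.locallyConnectedSpace
  -- Ellipticity does not apply to `p` itself, only to the harmonic functions `H_D p`. Their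
  -- positivity set is open and, since `H_D p ≤ p`, gives local lower bounds for `p`.
  set O : Set X := {y | ∃ D ∈ 𝒱, closure D ⊆ G ∧ y ∈ D ∧ 0 < ∫ z, p z ∂(H D y)} with hO
  have hy₀O : y₀ ∈ O := ⟨D₀, hD₀, hD₀G, hy₀, hpos⟩
  have hcont : ∀ D ∈ 𝒱, ∀ y ∈ D, ContinuousAt (fun y => ∫ z, p z ∂(H D y)) y := fun D hD y hy =>
    (hH.continuousOn_integral hD hp).continuousAt ((hH.isOpen hD).mem_nhds hy)
  have hOo : IsOpen O := by
    rw [isOpen_iff_mem_nhds]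
    rintro y ⟨D, hD, hDG, hyD, hy⟩
    filter_upwards [(hcont D hD y hyD).eventually (lt_mem_nhds hy),
      (hH.isOpen hD).mem_nhds hyD] with z hz hzD using ⟨D, hD, hDG, hzD, hz⟩
  have hlow : ∀ y ∈ O, ∃ δ > 0, ∀ᶠ z in 𝓝 y, δ ≤ p z := by
    rintro y ⟨D, hD, hDG, hyD, hy⟩
    refine ⟨_, half_pos hy, ?_⟩
    filter_upwards [(hcont D hD y hyD).eventually (lt_mem_nhds (half_lt_self hy)),
      (hH.isOpen hD).mem_nhds hyD] with z hz hzD using hz.le.trans (hsup D hD hDG z hzD)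
  have hOG : O ⊆ G := fun y ⟨D, _, hDG, hyD, _⟩ => hDG (subset_closure hyD)
  suffices hGO : G ⊆ O from fun y hy => hlow y (hGO hy)
  set O' := connectedComponentIn O y₀ with hO'
  have hO'o : IsOpen O' := hOo.connectedComponentIn
  have hO'O : O' ⊆ O := connectedComponentIn_subset _ _
  have hy₀O' : y₀ ∈ O' := mem_connectedComponentIn hy₀O
  refine (hGc.subset_of_closure_inter_subset hO'o ⟨y₀, hOG hy₀O, hy₀O'⟩ ?_).trans hO'O
  rintro z ⟨hzcl, hzG⟩
  by_contra hzO'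
  have hzO : z ∉ O := by
    intro hzO
    obtain ⟨w, hw1, hw2⟩ := mem_closure_iff.1 hzcl _ hOo.connectedComponentIn
      (mem_connectedComponentIn hzO)
    apply hzO'
    rw [hO', connectedComponentIn_eq hw2, ← connectedComponentIn_eq hw1]
    exact mem_connectedComponentIn hzO
  have hzy₀ : z ≠ y₀ := fun h => hzO (h ▸ hy₀O)
  -- Here `z` is a boundary point, in `G`, of the component `O'` of `O`. Excluding `y₀` from
  -- `closure D` guarantees that `O'` leaves `D`.
  obtain ⟨D, hD, hzD, hDG⟩ := hH.exists_closure_subset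
    (inter_mem (hG.mem_nhds hzG) (isOpen_compl_singleton.mem_nhds hzy₀))
  have hDo := hH.isOpen hD
  set D' := connectedComponentIn D z with hD'
  have hD'o : IsOpen D' := hDo.connectedComponentIn
  have hD'D : D' ⊆ D := connectedComponentIn_subset _ _
  have hzD' : z ∈ D' := mem_connectedComponentIn hzD
  have hz0 : ∫ w, p w ∂(H D z) = 0 := by
    refine le_antisymm (not_lt.1 fun h => hzO ⟨D, hD, hDG.trans inter_subset_left, hzD, h⟩)
      (integral_nonneg h0)
  have hzero : ∀ y ∈ D', ∫ w, p w ∂(H D y) = 0 := by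
    rcases hell D' hD'o ⟨⟨z, hzD'⟩, isPreconnected_connectedComponentIn⟩ _
      (hH.isHarmonicOn_integral hD hD'D hp) (fun y _ => integral_nonneg h0) with h | h
    · exact h
    · exact absurd (h z hzD') (by rw [hz0]; exact lt_irrefl 0)
  obtain ⟨y₁, hy₁D', hy₁O'⟩ := mem_closure_iff.1 hzcl D' hD'o hzD'
  have hy₀D : y₀ ∉ D := fun h => (hDG (subset_closure h)).2 rfl
  -- The connected set `O'` meets `D'` and its complement, so it meets the boundary of `D'`. At such
  -- a `w`, which lies on `frontier D`, `p` is bounded below by some `δ > 0` nearby, so `H_D p > 0`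
  -- at points of `D'` close to `w`, contradicting `hzero`.
  obtain ⟨w, hwO', hwf⟩ : ∃ w ∈ O', w ∈ closure D' \ D' := by
    by_contra! hno
    refine hy₀D (hD'D ((isPreconnected_connectedComponentIn (F := O) (x := y₀)
      ).subset_of_closure_inter_subset hD'o ⟨y₁, hy₁O', hy₁D'⟩ (fun w hw => ?_) hy₀O'))
    by_contra hwD'
    exact hno w hw.2 ⟨hw.1, hwD'⟩
  have hwD : w ∉ D := by
    intro hwD
    obtain ⟨v, hv1, hv2⟩ := mem_closure_iff.1 hwf.1 _ hDo.connectedComponentIn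
      (mem_connectedComponentIn hwD)
    apply hwf.2
    rw [hD', connectedComponentIn_eq hv2, ← connectedComponentIn_eq hv1]
    exact mem_connectedComponentIn hwD
  have hwfD : w ∈ frontier D := by
    rw [hDo.frontier_eq]
    exact ⟨closure_mono hD'D hwf.1, hwD⟩
  obtain ⟨δ, hδ, hδp⟩ := hlow w (hO'O hwO')
  obtain ⟨N, hNp, hN, hwN⟩ := mem_nhds_iff.1 hδp
  have hq : IsBddLsc (frontier D) δ (N.indicator fun _ => δ) := by
    refine ⟨measurable_const.indicator hN.measurableSet, fun x => ?_,
      (hN.lowerSemicontinuous_indicator hδ.le).lowerSemicontinuousOn _⟩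
    by_cases hx : x ∈ N
    · simpa [hx] using hδ.le
    · simpa [hx] using hδ.le
  have h1 := hH.eventually_lt_integral hD hq hwfD (t := 0) (by simpa [hwN] using hδ)
  rw [eventually_nhdsWithin_iff] at h1
  obtain ⟨y, hy, hy'⟩ := (mem_closure_iff_frequently.1 hwf.1).and_eventually h1 |>.exists
  have h2 := hH.integral_mono hD (hD'D hy) hq.isBddBorel hp fun x _ => by
    by_cases hx : x ∈ N
    · simpa [hx] using hNp hx
    · simpa [hx] using h0 x
  have h3 := hy' (hD'D hy)
  rw [hzero y hy] at h2
  linarith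

end StrongMinimumPrinciple

/-! ### Sweeping of hyperharmonic functions. -/

section Balayage

variable {X : Type*} [TopologicalSpace X] [T2Space X] [LocallyCompactSpace X]
  [SecondCountableTopology X] [MeasurableSpace X] [BorelSpace X]
  {𝒱 : Set (Set X)} {H : Set X → Kernel X X} {𝒲 : X → Set (Set X)} {V₀ : Set X}

/-- Bounded positive hyperharmonic functions on `U`. -/
structure IsBddHyperharmonic (𝒱 : Set (Set X)) (H : Set X → Kernel X X) (U : Set X) (C : ℝ)
    (g : X → ℝ) : Prop extends IsBddLsc U C g where
  integral_le : ∀ D ∈ 𝒱, closure D ⊆ U → ∀ y, ∫ z, g z ∂(H D y) ≤ g y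

/-- Inside `V` small means of `H_V g` reproduce it; outside, `H_V g = g` while the means only
decrease, because `H_V g ≤ g`. Lower semicontinuity across `frontier V` is `eventually_lt_integral`.
This permits iteration. -/
theorem IsSeparatingChoice.isBddHyperharmonic_integral (hS : IsSeparatingChoice 𝒱 H V₀ 𝒲)
    (hH : IsNormalBauerFamily 𝒱 H) {C : ℝ} {g : X → ℝ} (hg : IsBddHyperharmonic 𝒱 H V₀ C g)
    {V : Set X} (hV : V ∈ 𝒱) (hVV₀ : closure V ⊆ V₀) :
    IsBddHyperharmonic 𝒱 H V₀ C fun y => ∫ z, g z ∂(H V y) := by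
  have hB := hg.isBddBorel
  have hfr : frontier V ⊆ V₀ := frontier_subset_closure.trans hVV₀
  have hVo := hH.isOpen hV
  have hlsc : IsBddLsc V₀ C fun y => ∫ z, g z ∂(H V y) := by
    refine ⟨(hH.kernel hV hB).1, fun y => ?_, fun y hy t ht => ?_⟩
    · have := hH.isProbabilityMeasure hV y
      exact integral_mem_Icc hg.measurable hg.mem_Icc _
    by_cases hyV : y ∈ V
    · exact nhdsWithin_le_nhds (((hH.continuousOn_integral hV hB).continuousAt
        (hVo.mem_nhds hyV)).eventually (lt_mem_nhds ht))
    · simp only [hH.integral_of_notMem hV hyV] at ht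
      have h1 : ∀ᶠ z in 𝓝[V] y, t < ∫ w, g w ∂(H V z) := by
        by_cases hyc : y ∈ closure V
        · exact hH.eventually_lt_integral hV ⟨hg.measurable, hg.mem_Icc, hg.lsc.mono hfr⟩
            (by rw [hVo.frontier_eq]; exact ⟨hyc, hyV⟩) ht
        · rw [eventually_nhdsWithin_iff]
          filter_upwards [isClosed_closure.isOpen_compl.mem_nhds hyc] with z hz hzV using
            absurd (subset_closure hzV) hz
      rw [eventually_nhdsWithin_iff] at h1
      filter_upwards [hg.lsc y hy t ht, nhdsWithin_le_nhds h1] with z hz hz'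
      by_cases hzV : z ∈ V
      · exact hz' hzV
      · simpa only [hH.integral_of_notMem hV hzV] using hz
  refine ⟨hlsc, fun D hD hDV₀ y => ?_⟩
  refine hS.integral_le hH subset_rfl hlsc (fun y hy => ?_) hD hDV₀ y
  by_cases hyV : y ∈ V
  · refine ⟨V, hVo.mem_nhds hyV, fun W hW hWV => ?_⟩
    exact (hH.integral_integral hV ((hS.choice y hy).1 hW).1 hWV hB y).le
  · refine ⟨univ, univ_mem, fun W hW _ => ?_⟩
    obtain ⟨hW𝒱, hWV₀, hyW⟩ := (hS.choice y hy).1 hW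
    calc ∫ z, ∫ w, g w ∂(H V z) ∂(H W y) ≤ ∫ z, g z ∂(H W y) :=
          hH.integral_mono hW𝒱 hyW (hH.kernel hV hB) hB fun z _ => hg.integral_le V hV hVV₀ z
      _ ≤ g y := hg.integral_le W hW𝒱 hWV₀ y
      _ = ∫ z, g z ∂(H V y) := (hH.integral_of_notMem hV hyV g).symm

/-- Sweeping a bounded hyperharmonic function on `V₀` out of the complement of a closed set. -/
theorem IsSeparatingChoice.exists_balayage (hS : IsSeparatingChoice 𝒱 H V₀ 𝒲)
    (hH : IsNormalBauerFamily 𝒱 H) (hV₀ : IsOpen V₀) {C : ℝ} {g : X → ℝ}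
    (hg : IsBddHyperharmonic 𝒱 H V₀ C g) {L : Set X} (hL : IsClosed L) :
    ∃ τ : X → ℝ, Measurable τ ∧ (∀ y, τ y ∈ Icc 0 C) ∧
      (∀ D ∈ 𝒱, closure D ⊆ V₀ → ∀ y, ∫ z, τ z ∂(H D y) ≤ τ y) ∧ (∀ y ∈ L, τ y = g y) ∧
      ContinuousOn τ (V₀ \ L) ∧
      ∀ D ∈ 𝒱, closure D ⊆ V₀ \ L → ∀ y, ∫ z, τ z ∂(H D y) = τ y := by
  classical
  have hU : IsOpen (V₀ \ L) := hV₀.sdiff hL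
  obtain ⟨𝒞, h𝒞𝒱, h𝒞c, h𝒞b⟩ := hH.isBasis.exists_countable
  obtain ⟨e, he⟩ := countable_iff_exists_subset_range.1 h𝒞c
  let step : Set X → (X → ℝ) → X → ℝ := fun V f =>
    if V ∈ 𝒱 ∧ closure V ⊆ V₀ \ L then fun y => ∫ z, f z ∂(H V y) else f
  -- Through `Nat.unpair` every set of the countable base is used infinitely often, so the
  -- decreasing limit is invariant under each admissible `H_V`.
  let T : ℕ → X → ℝ := fun n => Nat.rec g (fun n f => step (e n.unpair.1) f) n
  have hTs : ∀ n, T (n + 1) = step (e n.unpair.1) (T n) := fun n => rfl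
  have hT : ∀ n, IsBddHyperharmonic 𝒱 H V₀ C (T n) := by
    intro n
    induction n with
    | zero => exact hg
    | succ n ih =>
      rw [hTs]
      simp only [step]
      split_ifs with h
      · exact hS.isBddHyperharmonic_integral hH ih h.1 (h.2.trans sdiff_subset)
      · exact ih
  have hTL : ∀ n, ∀ y ∈ L, T n y = g y := by
    intro n y hy
    induction n with
    | zero => rfl
    | succ n ih =>
      rw [hTs]
      simp only [step]
      split_ifs with h
      · exact (hH.integral_of_notMem h.1 (fun hyV => (h.2 (subset_closure hyV)).2 hy) _).trans ih
      · exact ih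
  have hanti : ∀ y, Antitone fun n => T n y := by
    refine fun y => antitone_nat_of_succ_le fun n => ?_
    rw [hTs]
    simp only [step]
    split_ifs with h
    · exact (hT n).integral_le _ h.1 (h.2.trans sdiff_subset) y
    · exact le_rfl
  have hlim : ∀ y, Tendsto (fun n => T n y) atTop (𝓝 (⨅ n, T n y)) := fun y =>
    tendsto_atTop_ciInf (hanti y) ⟨0, by rintro _ ⟨n, rfl⟩; exact ((hT n).mem_Icc y).1⟩
  set τ : X → ℝ := fun y => ⨅ n, T n y with hτ
  have hτm : Measurable τ := measurable_of_tendsto_metrizable (fun n => (hT n).measurable)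
    (tendsto_pi_nhds.2 hlim)
  have hτC : ∀ y, τ y ∈ Icc 0 C := fun y =>
    isClosed_Icc.mem_of_tendsto (hlim y) (Eventually.of_forall fun n => (hT n).mem_Icc y)
  have hτB : IsBddBorel τ := .of_mem_Icc hτm hτC
  have hint : ∀ D ∈ 𝒱, ∀ y, Tendsto (fun n => ∫ z, T n z ∂(H D y)) atTop
      (𝓝 (∫ z, τ z ∂(H D y))) := by
    intro D hD y
    have := hH.isProbabilityMeasure hD y
    refine tendsto_integral_of_dominated_convergence (fun _ => C)
      (fun n => (hT n).measurable.aestronglyMeasurable) (integrable_const C)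
      (fun n => Eventually.of_forall fun z => ?_) (Eventually.of_forall hlim)
    rw [Real.norm_eq_abs, abs_of_nonneg ((hT n).mem_Icc z).1]
    exact ((hT n).mem_Icc z).2
  have hfix : ∀ V ∈ 𝒞, closure V ⊆ V₀ \ L → ∀ y, ∫ z, τ z ∂(H V y) = τ y := by
    intro V hV hVU y
    obtain ⟨k, rfl⟩ := he hV
    have hk : Tendsto (fun m => Nat.pair k m) atTop atTop :=
      tendsto_atTop_mono (fun m => Nat.right_le_pair k m) tendsto_id
    have h1 := (hint _ (h𝒞𝒱 hV) y).comp hk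
    have h2 := (hlim y).comp ((tendsto_add_atTop_nat 1).comp hk)
    refine tendsto_nhds_unique h1 (h2.congr fun m => ?_)
    simp only [Function.comp_apply, hTs, Nat.unpair_pair, step]
    rw [if_pos ⟨h𝒞𝒱 hV, hVU⟩]
  have hcover : ∀ y ∈ V₀ \ L, ∃ V ∈ 𝒞, y ∈ V ∧ closure V ⊆ V₀ \ L := by
    intro y hy
    obtain ⟨K, hK, hKc, hKU⟩ := exists_mem_nhds_isClosed_subset (hU.mem_nhds hy)
    obtain ⟨V, hV, hyV, hVK⟩ := h𝒞b.mem_nhds_iff.1 hK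
    exact ⟨V, hV, hyV, (closure_minimal hVK hKc).trans hKU⟩
  -- Invariance makes `τ` locally an integral `H_V τ`, so the strong Feller property yields
  -- continuity.
  have hτc : ContinuousOn τ (V₀ \ L) := by
    intro y hy
    obtain ⟨V, hV, hyV, hVU⟩ := hcover y hy
    have h1 := (hH.continuousOn_integral (h𝒞𝒱 hV) hτB).continuousAt
      ((hH.isOpen (h𝒞𝒱 hV)).mem_nhds hyV)
    rw [show (fun y => ∫ z, τ z ∂(H V y)) = τ from funext (hfix V hV hVU)] at h1
    exact h1.continuousWithinAt
  refine ⟨τ, hτm, hτC, fun D hD hDV₀ y => ?_, fun y hy => ?_, hτc, fun D hD hDU y => ?_⟩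
  · exact le_of_tendsto_of_tendsto' (hint D hD y) (hlim y) fun n => (hT n).integral_le D hD hDV₀ y
  · simp [hτ, hTL _ y hy]
  · refine hS.integral_eq hH (sdiff_subset (t := L)) hτm hτC hτc (fun y hy => ?_) hD hDU y
    obtain ⟨V, hV, hyV, hVU⟩ := hcover y hy
    refine ⟨V, (hH.isOpen (h𝒞𝒱 hV)).mem_nhds hyV, fun W hW hWV => ?_⟩
    have h1 := hH.integral_integral (h𝒞𝒱 hV) ((hS.choice y hy.1).1 hW).1 hWV hτB y
    simp only [hfix V hV hVU] at h1
    exact h1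

end Balayage

end BauerSpace

namespace BauerSpace

/-! ### Superlevel sets of potentials, and functions that are not harmonic. -/

section StronglyStable

variable {X : Type*} [TopologicalSpace X] [T2Space X] [LocallyCompactSpace X]
  [SecondCountableTopology X] [MeasurableSpace X] [BorelSpace X]
  {𝒱 : Set (Set X)} {H : Set X → Kernel X X} {𝒲 : X → Set (Set X)} {V₀ : Set X}

/-- The superlevel sets of a function that is harmonic outside a compact set `L`, large near `L`
and zero at the boundary are strongly stable. -/
theorem isStronglyStable_superlevel (hH : IsNormalBauerFamily 𝒱 H) {W L : Set X}
    (hW : IsPSet 𝒱 H W) (hWc : IsCompact (closure W)) (hL : IsCompact L) (hLW : L ⊆ W)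
    (hLne : L.Nonempty) {p : X → ℝ} (hp : IsBddBorel p) (hph : IsHarmonicOn 𝒱 H (W \ L) p)
    {a : ℝ} (ha : 0 < a) (hpL : ∀ y ∈ L, ∀ᶠ z in 𝓝 y, a < p z)
    (hp0 : ∀ z ∈ frontier W, Tendsto p (𝓝[W] z) (𝓝 0)) :
    IsStronglyStable 𝒱 H {y ∈ W | a ≤ p y} := by
  have hWo := hW.1
  have hWL : IsOpen (W \ L) := hWo.sdiff hL.isClosed
  set K := {y ∈ W | a ≤ p y} with hK
  have hLK : L ⊆ K := fun y hy => ⟨hLW hy, (hpL y hy).self_of_nhds.le⟩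
  have hcont : ∀ z ∈ W \ L, ContinuousAt p z := fun z hz => hph.1.continuousAt (hWL.mem_nhds hz)
  have hKc : IsClosed K := by
    rw [← closure_subset_iff_isClosed]
    intro z hz
    have hzW : z ∈ W := by
      by_contra hzW
      have hzf : z ∈ frontier W := by
        rw [hWo.frontier_eq]
        exact ⟨closure_mono (sep_subset _ _) hz, hzW⟩
      have h1 := (hp0 z hzf).eventually (gt_mem_nhds ha)
      rw [eventually_nhdsWithin_iff] at h1
      obtain ⟨y, hy, hy'⟩ := (mem_closure_iff_frequently.1 hz).and_eventually h1 |>.exists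
      exact absurd (hy' hy.1) (not_lt.2 hy.2)
    by_cases hzL : z ∈ L
    · exact hLK hzL
    · refine ⟨hzW, not_lt.1 fun hlt => ?_⟩
      have h1 := (hcont z ⟨hzW, hzL⟩).eventually (gt_mem_nhds hlt)
      obtain ⟨y, hy, hy'⟩ := (mem_closure_iff_frequently.1 hz).and_eventually h1 |>.exists
      exact absurd hy' (not_lt.2 hy.2)
  have hsub : W \ K ⊆ W \ L := sdiff_subset_sdiff_right hLK
  refine ⟨hLne.mono hLK, hWc.of_isClosed_subset hKc ((sep_subset _ _).trans subset_closure), W, hW,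
    sep_subset _ _, fun y => a - p y, ⟨continuousOn_const.sub (hph.1.mono hsub),
      fun V hV hVU y hy => ?_⟩, fun y hy => ?_, fun z hz => ?_⟩
  · rw [hH.integral_sub hV (.const a) hp, hH.integral_const hV,
      hph.2 V hV (hVU.trans hsub) y hy]
  · have : ¬ a ≤ p y := fun h => hy.2 ⟨hy.1, h⟩
    linarith
  · have hzK : z ∈ K := hKc.frontier_subset hz
    -- Near `L` the inequality `p > a` is strict, so `frontier K` avoids `L`; there `p` is
    -- continuous with value `a`.
    have hint : ¬ ∀ᶠ y in 𝓝 z, a < p y := fun h => by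
      refine hz.2 (mem_interior_iff_mem_nhds.2 ?_)
      filter_upwards [h, hWo.mem_nhds hzK.1] with y hy hyW using ⟨hyW, hy.le⟩
    have hzc := hcont z ⟨hzK.1, fun hzL => hint (hpL z hzL)⟩
    have hpz : p z = a := le_antisymm
      (not_lt.1 fun hlt => hint (hzc.eventually (lt_mem_nhds hlt))) hzK.2
    have h1 : Tendsto (fun y => a - p y) (𝓝 z) (𝓝 (a - p z)) := tendsto_const_nhds.sub hzc
    rw [hpz, sub_self] at h1
    exact h1.mono_left nhdsWithin_le_nhds

/-- If `B` were `{x}`, the unit mass `H D x` would sit on a frontier contained in `{x}`, although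
`x` lies in the open set `D`. -/
theorem IsNormalBauerFamily.exists_mem_ne (hH : IsNormalBauerFamily 𝒱 H) {B : Set X}
    (hB : IsOpen B) {x : X} (hx : x ∈ B) : ∃ b ∈ B, x ≠ b := by
  by_contra! hno
  obtain ⟨D, hD, hxD, hDB⟩ := hH.exists_closure_subset (hB.mem_nhds hx)
  have := hH.isProbabilityMeasure hD x
  have h1 : ∀ᵐ z ∂(H D x), False := by
    filter_upwards [hH.ae_mem_frontier hD hxD] with z hz
    rw [(hH.isOpen hD).frontier_eq] at hz
    exact hz.2 (hno z (hDB hz.1) ▸ hxD)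
  have h2 := ae_iff.1 h1
  simp at h2

/-- Ellipticity provides bounded hyperharmonic functions that are not harmonic on a given connected
open set. -/
theorem IsSeparatingChoice.exists_not_harmonic (hS : IsSeparatingChoice 𝒱 H V₀ 𝒲)
    (hH : IsNormalBauerFamily 𝒱 H) (hell : IsElliptic 𝒱 H) {B : Set X} (hB : IsOpen B)
    (hBc : IsConnected B) (hBV : B ⊆ V₀) : ∃ (C : ℝ) (g : X → ℝ), IsBddHyperharmonic 𝒱 H V₀ C g ∧
      ∀ k : X → ℝ, IsHarmonicOn 𝒱 H B k → ¬ EqOn k g B := by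
  obtain ⟨x, hx⟩ := hBc.nonempty
  obtain ⟨b, hb, hxb⟩ := hH.exists_mem_ne hB hx
  obtain ⟨C, g, hg, hgW, hne⟩ := hS.separates x (hBV hx) b (hBV hb) hxb
  obtain ⟨y, hy, z, hz, hyz⟩ : ∃ y ∈ B, ∃ z ∈ B, g y < g z := by
    rcases lt_or_gt_of_ne hne with h | h
    · exact ⟨x, hx, b, hb, h⟩
    · exact ⟨b, hb, x, hx, h⟩
  have hgs := fun D hD hDV => hS.integral_le hH subset_rfl hg
    (fun y hy => ⟨univ, univ_mem, fun W hW _ => hgW y hy W hW⟩) (D := D) hD hDV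
  -- Truncation at the larger value `g z` produces a maximum at `z`. If the truncation agreed with a
  -- harmonic `k` on `B`, then `g z - k` would be a positive harmonic function vanishing at `z` but
  -- not at `y`.
  have hm : IsBddLsc V₀ C fun w => min (g w) (g z) :=
    ⟨hg.measurable.min measurable_const, fun w => ⟨le_min (hg.mem_Icc w).1 (hg.mem_Icc z).1,
      (min_le_left _ _).trans (hg.mem_Icc w).2⟩, hg.lsc.inf lowerSemicontinuousOn_const⟩
  refine ⟨C, fun w => min (g w) (g z), ⟨hm, fun D hD hDV w => le_min ?_ ?_⟩, fun k hk heq => ?_⟩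
  · exact (MeasureTheory.integral_mono (hH.integrable hD hm.isBddBorel w)
      (hH.integrable hD hg.isBddBorel w) fun _ => min_le_left _ _).trans (hgs D hD hDV w)
  · exact (MeasureTheory.integral_mono (hH.integrable hD hm.isBddBorel w)
      (hH.integrable hD (.const (g z)) w) fun _ => min_le_right _ _).trans
      (hH.integral_const hD _ w).le
  have hkh : IsHarmonicOn 𝒱 H B fun w => g z - k w := by
    refine ⟨continuousOn_const.sub hk.1, fun V hV hVB w hw => ?_⟩
    have hi : Integrable k (H V w) := by
      refine (hH.integrable hV hm.isBddBorel w).congr ?_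
      filter_upwards [hH.ae_mem_frontier hV hw] with v hv using
        (heq (hVB (frontier_subset_closure hv))).symm
    have := hH.isProbabilityMeasure hV w
    rw [MeasureTheory.integral_sub (integrable_const _) hi, hH.integral_const hV, hk.2 V hV hVB w hw]
  have hkz : k z = g z := by simpa using heq hz
  have hky : k y = g y := by simpa [hyz.le] using heq hy
  rcases hell B hB hBc _ hkh (fun w hw => by
    have : k w = min (g w) (g z) := heq hw
    simp [this]) with h | h
  · have := h y hy
    linarith
  · have := h z hz
    linarith

end StronglyStable

end BauerSpace

/-! ### Construction of the strongly stable neighborhood. -/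

theorem lemma5p1 {X : Type*} [TopologicalSpace X] [T2Space X] [LocallyCompactSpace X]
    [SecondCountableTopology X] [MeasurableSpace X] [BorelSpace X]
    (𝒱 : Set (Set X)) (H : Set X → Kernel X X)
    (hH : BauerSpace.IsNormalBauerFamily 𝒱 H) (hell : BauerSpace.IsElliptic 𝒱 H)
    (x : X) (V : Set X) (hV : IsOpen V) (hxV : x ∈ V) :
    ∃ K : Set X, BauerSpace.IsStronglyStable 𝒱 H K ∧ K ∈ 𝓝 x ∧ K ⊆ V := by
  have := hH.locallyConnectedSpace
  obtain ⟨V₀, hV₀, hxV₀, hV₀V⟩ := hH.exists_closure_subset (hV.mem_nhds hxV)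
  have hV₀o := hH.isOpen hV₀
  obtain ⟨𝒲, hS⟩ := hH.exists_isSeparatingChoice hV₀
  obtain ⟨W, hW, hxW, hWV₀⟩ := hH.exists_closure_subset (hV₀o.mem_nhds hxV₀)
  have hWo := hH.isOpen hW
  have hWV₀' : W ⊆ V₀ := subset_closure.trans hWV₀
  set G := connectedComponentIn W x with hG
  have hGo : IsOpen G := hWo.connectedComponentIn
  have hGW : G ⊆ W := connectedComponentIn_subset _ _
  obtain ⟨E, hE, hxE, hEG⟩ := hH.exists_closure_subset
    (hGo.mem_nhds (mem_connectedComponentIn hxW))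
  set B := connectedComponentIn E x with hB
  have hBo : IsOpen B := (hH.isOpen hE).connectedComponentIn
  have hxB : x ∈ B := mem_connectedComponentIn hxE
  have hBE : closure B ⊆ closure E := closure_mono (connectedComponentIn_subset _ _)
  have hBG : closure B ⊆ G := hBE.trans hEG
  have hBc : IsCompact (closure B) := (hH.relCompact E hE).of_isClosed_subset isClosed_closure hBE
  have hBW : B ⊆ W := (subset_closure.trans hBG).trans hGW
  obtain ⟨C, g, hg, hgB⟩ := hS.exists_not_harmonic hH hell hBo
    ⟨⟨x, hxB⟩, isPreconnected_connectedComponentIn⟩ (hBW.trans hWV₀')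
  obtain ⟨τ, hτm, hτC, hτs, hτg, hτc, hτh⟩ := hS.exists_balayage hH hV₀o hg
    (isClosed_closure (s := B))
  have hτB : BauerSpace.IsBddBorel τ := .of_mem_Icc hτm hτC
  have hkB := hH.kernel hW hτB
  set p : X → ℝ := fun y => τ y - ∫ z, τ z ∂(H W y) with hp
  have hpB : BauerSpace.IsBddBorel p := hτB.sub hkB
  have hp0 : ∀ y, 0 ≤ p y := fun y => sub_nonneg.2 (hτs W hW hWV₀ y)
  have hpint : ∀ D ∈ 𝒱, D ⊆ W → ∀ y,
      ∫ z, p z ∂(H D y) = ∫ z, τ z ∂(H D y) - ∫ z, τ z ∂(H W y) := fun D hD hDW y => by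
    rw [hH.integral_sub hD hτB hkB, hH.integral_integral hW hD hDW hτB]
  have hps : ∀ D ∈ 𝒱, closure D ⊆ G → ∀ y ∈ D, ∫ z, p z ∂(H D y) ≤ p y := by
    intro D hD hDG y _
    have hDW := hDG.trans hGW
    rw [hpint D hD (subset_closure.trans hDW)]
    exact sub_le_sub_right (hτs D hD ((hDW.trans hWV₀')) y) _
  have hph : BauerSpace.IsHarmonicOn 𝒱 H (W \ closure B) p := by
    refine ⟨(hτc.mono (sdiff_subset_sdiff_left hWV₀')).sub
      ((hH.continuousOn_integral hW hτB).mono sdiff_subset), fun D hD hDU y _ => ?_⟩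
    rw [hpint D hD (subset_closure.trans (hDU.trans sdiff_subset)),
      hτh D hD (hDU.trans (sdiff_subset_sdiff_left hWV₀'))]
  obtain ⟨y₀, hy₀B, hy₀⟩ : ∃ y ∈ B, 0 < p y := by
    by_contra! hno
    refine hgB _ (hH.isHarmonicOn_integral hW hBW hτB) fun y hy => ?_
    have h1 := le_antisymm (hno y hy) (hp0 y)
    rw [← hτg y (subset_closure hy)]
    simp only [hp] at h1
    linarith
  -- Near `y₀` the function `τ` agrees with the lower semicontinuous `g`, and `H_W τ` is continuous.
  -- An error of `p y₀ / 4` for each leaves `p > p y₀ / 2`, whence a positive mean over a small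
  -- `D₀`.
  obtain ⟨D₀, hD₀, hy₀D₀, hD₀N⟩ : ∃ D ∈ 𝒱, y₀ ∈ D ∧ closure D ⊆ {z | p y₀ / 2 < p z ∧ z ∈ B} := by
    refine hH.exists_closure_subset ?_
    have h1 := hg.lsc y₀ (hWV₀' (hBW hy₀B)) (τ y₀ - p y₀ / 4)
      (by rw [hτg y₀ (subset_closure hy₀B)]; linarith)
    rw [hV₀o.nhdsWithin_eq (hWV₀' (hBW hy₀B))] at h1
    have h2 : ∀ᶠ y in 𝓝 y₀, ∫ z, τ z ∂(H W y) < ∫ z, τ z ∂(H W y₀) + p y₀ / 4 :=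
      ((hH.continuousOn_integral hW hτB).continuousAt (hWo.mem_nhds (hBW hy₀B))).eventually
        (gt_mem_nhds (lt_add_of_pos_right _ (by linarith)))
    filter_upwards [h1, h2, hBo.mem_nhds hy₀B] with z hz1 hz2 hzB
    refine ⟨?_, hzB⟩
    rw [← hτg z (subset_closure hzB)] at hz1
    simp only [hp] at hz1 hz2 ⊢
    linarith
  have hpos : 0 < ∫ z, p z ∂(H D₀ y₀) := by
    have h1 := hH.integral_mono hD₀ hy₀D₀ (.const (p y₀ / 2)) hpB fun z hz =>
      (hD₀N (frontier_subset_closure hz)).1.le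
    rw [hH.integral_const hD₀] at h1
    linarith
  have hlow := hH.exists_pos_lower_bound hell hGo isPreconnected_connectedComponentIn hpB hp0 hps
    hD₀ ((hD₀N.trans fun z hz => hz.2).trans (subset_closure.trans hBG)) hy₀D₀ hpos
  obtain ⟨a, ha, hpa⟩ : ∃ a > 0, ∀ y ∈ closure B, ∀ᶠ z in 𝓝 y, a < p z := by
    refine hBc.induction_on (p := fun s => ∃ a > 0, ∀ y ∈ s, ∀ᶠ z in 𝓝 y, a < p z)
      ⟨1, one_pos, by simp⟩ (fun s t hst ⟨a, ha, h⟩ => ⟨a, ha, fun y hy => h y (hst hy)⟩) ?_ ?_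
    · rintro s t ⟨a, ha, h⟩ ⟨b, hb, h'⟩
      refine ⟨min a b, lt_min ha hb, ?_⟩
      rintro y (hy | hy)
      · exact (h y hy).mono fun z hz => (min_le_left _ _).trans_lt hz
      · exact (h' y hy).mono fun z hz => (min_le_right _ _).trans_lt hz
    · intro y hy
      obtain ⟨δ, hδ, h⟩ := hlow y (hBG hy)
      exact ⟨_, mem_nhdsWithin_of_mem_nhds (eventually_eventually_nhds.2 h), δ / 2, half_pos hδ,
        fun z hz => hz.mono fun w hw => (half_lt_self hδ).trans_le hw⟩
  have hlim : ∀ z ∈ frontier W, Tendsto p (𝓝[W] z) (𝓝 0) := by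
    intro z hz
    have hzW : z ∉ W := by
      rw [hWo.frontier_eq] at hz
      exact hz.2
    have hfr : frontier W ⊆ V₀ \ closure B := fun w hw => by
      rw [hWo.frontier_eq] at hw
      exact ⟨hWV₀ hw.1, fun h => hw.2 (hGW (hBG h))⟩
    have h1 : Tendsto τ (𝓝[W] z) (𝓝 (τ z)) :=
      ((hτc.continuousAt ((hV₀o.sdiff isClosed_closure).mem_nhds (hfr hz))).tendsto).mono_left
        nhdsWithin_le_nhds
    -- `τ` is known to be continuous only on `V₀ \ closure B`, so continuity of `H_W` on continuous
    -- functions does not apply directly; boundary lower semicontinuity is used for both `τ` and `C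
    -- - τ`.
    have h2 : Tendsto (fun y => ∫ w, τ w ∂(H W y)) (𝓝[W] z) (𝓝 (τ z)) := by
      rw [tendsto_order]
      refine ⟨fun t ht => hH.eventually_lt_integral hW
        ⟨hτm, hτC, (hτc.mono hfr).lowerSemicontinuousOn⟩ hz ht, fun t ht => ?_⟩
      have h3 := hH.eventually_lt_integral hW (C := C) (g := fun y => C - τ y)
        ⟨measurable_const.sub hτm,
          fun y => ⟨by linarith [(hτC y).2], by linarith [(hτC y).1]⟩,
          (continuousOn_const.sub (hτc.mono hfr)).lowerSemicontinuousOn⟩ hz (t := C - t)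
        (by linarith)
      filter_upwards [h3] with y hy
      rw [hH.integral_sub hW (.const C) hτB, hH.integral_const hW] at hy
      linarith
    simpa using h1.sub h2
  refine ⟨{y ∈ W | a ≤ p y}, BauerSpace.isStronglyStable_superlevel hH (hS.isPSet hH hWo hWV₀')
    (hH.relCompact W hW) hBc (hBG.trans hGW) ⟨x, subset_closure hxB⟩ hpB hph ha hpa hlim, ?_,
    ((sep_subset _ _).trans hWV₀').trans (subset_closure.trans hV₀V)⟩
  filter_upwards [hpa x (subset_closure hxB), hWo.mem_nhds hxW] with y hy hyW using ⟨hyW, hy.le⟩
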